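/- **Setting.** Let $f:\mathbb R^n\to\mathbb R$ be convex and $L$-smooth ($L>0$: $f$ is differentiable and $\nabla f$ is $L$-Lipschitz in the Euclidean norm), let $x^*$ be a minimizer of $f$, $x^0\in\mathbb R^n$, and $R_0=\|x^0-x^*\|_2>0$. Let $\xi$ be a random variable and $\nabla f(x,\xi)$ a stochastic gradient (jointly measurable in $(x,\xi)$) with $\mathbb E_\xi[\nabla f(x,\xi)]=\nabla f(x)$ and $\mathbb E_\xi\|\nabla f(x,\xi)-\nabla f(x)\|_2^2\le\sigma^2$ for all $x$, where $\sigma\ge 0$. Let $\beta\in(0,1)$ and $C=\sqrt5$. **Method (clipped-SSTM).** Given $N$, $a$, $B$ and batchsizes $m_k$, put $A_0=\alpha_0=0$, $y^0=z^0=x^0$ and, for $k=0,\dots,N-1$, $\alpha_{k+1}=\frac{k+2}{2aL}$, $A_{k+1}=A_k+\alpha_{k+1}$, $x^{k+1}=\frac{A_ky^k+\alpha_{k+1}z^k}{A_{k+1}}$, $g^{k+1}=\frac1{m_k}\sum_{i=1}^{m_k}\nabla f(x^{k+1},\xi_i^k)$ with fresh i.i.d. samples $\xi_i^k$ distributed as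 $\xi$, $\tilde g^{k+1}=\min\{1,\frac{B}{\alpha_{k+1}\|g^{k+1}\|_2}\}\,g^{k+1}$ (equal to $0$ if $g^{k+1}=0$), $z^{k+1}=z^k-\alpha_{k+1}\tilde g^{k+1}$, $y^{k+1}=\frac{A_ky^k+\alpha_{k+1}z^{k+1}}{A_{k+1}}$. The output is $y^N$ and the number of oracle calls is $\sum_{k=0}^{N-1}m_k$. The clipping parameter is $B=\frac{CR_0}{8\ln(4N/\beta)}$, and the batchsize is (rounded up to an integer) $$m_k=\max\Big\{1,\tfrac{6000\sigma^2\alpha_{k+1}^2N\ln\frac{4N}\beta}{C^2R_0^2},\tfrac{10368\sigma^2\alpha_{k+1}^2N}{C^2R_0^2}\Big\}.$$ Call $(N,a)$ *admissible* if $N\ge1$, $\ln\frac{4N}\beta\ge2$ and $$a\ge\max\Big\{1,\tfrac{16\ln\frac{4N}\beta}{C},36\Big(2\ln\tfrac{4N}\beta+\sqrt{4\ln^2\tfrac{4N}\beta+2\ln\tfrac{4N}\beta}\Big)^2\Big\}.$$ **Claim.** There are numerical constants $K,K'>0$, independent of all the data ($n,f,x^0,x^*,L,\sigma,\beta$, the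 stochastic gradient and the distribution of $\xi$, and $N,\varepsilon,a_0$ below), such that the following holds. 1. *(Medium batchsize.)* Put $a=N\ln\frac{4N}\beta$ and, for $\varepsilon>0$, $T=\frac{LR_0^2}\varepsilon\ln\frac{LR_0^2}{\varepsilon\beta}$. If $(N,a)$ is admissible, then before rounding $$m_k=\max\Big\{1,\tfrac{6000\sigma^2(k+2)^2}{4L^2NC^2R_0^2\ln\frac{4N}\beta},\tfrac{10368\sigma^2(k+2)^2}{4L^2C^2R_0^2N\ln^2\frac{4N}\beta}\Big\};$$ for every $\varepsilon>0$ with $N\ge KT$ one has $f(y^N)-f(x^*)\le\varepsilon$ with probability at least $1-\beta$; and for every $\varepsilon>0$ with $N\le2KT$ the number of oracle calls is at most $$K'\max\Big\{\tfrac{LR_0^2}\varepsilon,\tfrac{\sigma^2R_0^2}{\varepsilon^2}\Big\}\ln\tfrac{LR_0^2}{\varepsilon\beta}.$$ If $0<\varepsilon\le\frac12LR_0^2$, there is $N$ with $KT\le N\le2KT$ for which $(N,a)$ is admissible. 2. *(Constant batchsize.)* Let $a_0>0$, put $a=a_0N^{3/2}\sqrt{\ln\frac{4N}\beta}$ and,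 for $\varepsilon>0$, $T=\frac{a_0^2L^2R_0^4}{\varepsilon^2}\ln\frac{a_0LR_0^2}{\varepsilon\beta}$. If $(N,a)$ is admissible, then before rounding $$m_k=\max\Big\{1,\tfrac{6000\sigma^2(k+2)^2}{4a_0^2L^2N^2C^2R_0^2},\tfrac{10368\sigma^2(k+2)^2}{4a_0^2L^2C^2R_0^2N^2\ln\frac{4N}\beta}\Big\};$$ for every $0<\varepsilon\le\frac12a_0LR_0^2$ with $N\ge KT$ one has $f(y^N)-f(x^*)\le\varepsilon$ with probability at least $1-\beta$; and for every $\varepsilon>0$ with $N\le2KT$ the number of oracle calls is at most $$K'\max\Big\{\tfrac{a_0^2L^2R_0^4}{\varepsilon^2},\tfrac{\sigma^2R_0^2}{\varepsilon^2}\Big\}\ln\tfrac{a_0LR_0^2}{\varepsilon\beta}.$$ If $0<\varepsilon\le\frac12a_0LR_0^2$ and $\varepsilon^3\le a_0^4(LR_0^2)^3$, there is $N$ with $KT\le N\le2KT$ for which $(N,a)$ is admissible. Finally, let $\sigma>0$ and $a_0=\frac\sigma{LR_0}$, so that $T=\frac{\sigma^2R_0^2}{\varepsilon^2}\ln\frac{\sigma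 R_0}{\varepsilon\beta}$. If $(N,a)$ is admissible, then $m_k\le K'$ for $k=0,\dots,N$ (so each iteration needs at most $K'$ oracle calls), and for every $0<\varepsilon\le\frac12\sigma R_0$ with $N\ge KT$ one has $f(y^N)-f(x^*)\le\varepsilon$ with probability at least $1-\beta$. If $0<\varepsilon\le\frac12\sigma R_0$ and $L\varepsilon^3\le\sigma^4R_0^2$, there is $N$ with $KT\le N\le2KT$ for which $(N,a)$ is admissible. -/

import Mathlib

open MeasureTheory ProbabilityTheory

noncomputable section

namespace ClippedSSTM

/-- `ℝⁿ` with the Euclidean norm. -/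
abbrev Euc (n : ℕ) := EuclideanSpace ℝ (Fin n)

/-- `f` is `L`-smooth: differentiable with `L`-Lipschitz gradient. -/
def LSmooth {n : ℕ} (f : Euc n → ℝ) (L : ℝ) : Prop :=
  Differentiable ℝ f ∧ ∀ x y, ‖gradient f x - gradient f y‖ ≤ L * ‖x - y‖

/-- `G x ζ`, with `ζ` distributed according to `P`, is an unbiased estimator of `∇ f x` whose
variance is at most `σ ^ 2` at every point `x`. -/
structure IsStochasticGradient {n : ℕ} {Ξ : Type*} [MeasurableSpace Ξ]
    (f : Euc n → ℝ) (P : Measure Ξ) (G : Euc n → Ξ → Euc n) (σ : ℝ) : Prop where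
  measurable : Measurable (Function.uncurry G)
  integrable : ∀ x, Integrable (G x) P
  unbiased : ∀ x, ∫ ζ, G x ζ ∂P = gradient f x
  integrable_sq : ∀ x, Integrable (fun ζ => ‖G x ζ - gradient f x‖ ^ 2) P
  variance_le : ∀ x, ∫ ζ, ‖G x ζ - gradient f x‖ ^ 2 ∂P ≤ σ ^ 2

/-- `ξ (k, i)`, for `k, i : ℕ`, are independent samples with common distribution `P`. -/
structure IsIIDSample {Ξ Ω : Type*} [MeasurableSpace Ξ] [MeasurableSpace Ω]
    (μ : Measure Ω) (P : Measure Ξ) (ξ : ℕ × ℕ → Ω → Ξ) : Prop where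
  measurable : ∀ p, Measurable (ξ p)
  map_eq : ∀ p, μ.map (ξ p) = P
  indep : iIndepFun ξ μ

/-- The stepsizes: `α 0 = 0` and `α (k + 1) = (k + 2) / (2 a L)`. -/
def stepα (a L : ℝ) : ℕ → ℝ
  | 0 => 0
  | k + 1 => ((k : ℝ) + 2) / (2 * a * L)

/-- `A 0 = 0` and `A (k + 1) = A k + α (k + 1)`. -/
def stepA (a L : ℝ) : ℕ → ℝ
  | 0 => 0
  | k + 1 => stepA a L k + stepα a L (k + 1)

/-- The clipping operator `clip(v, lam) = min {1, lam / ‖v‖} v`. -/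
def clip {n : ℕ} (v : Euc n) (lam : ℝ) : Euc n := min 1 (lam / ‖v‖) • v

/-- The mini-batch stochastic gradient at `x` computed from the samples `s 0, …, s (m - 1)`. -/
def miniBatch {n : ℕ} {Ξ : Type*} (G : Euc n → Ξ → Euc n) (x : Euc n) (m : ℕ) (s : ℕ → Ξ) :
    Euc n :=
  (m : ℝ)⁻¹ • ∑ i ∈ Finset.range m, G x (s i)

/-- The iterates `(y^k, z^k)` of `clipped-SSTM` started at `x₀`, with stepsize parameter `a`,
clipping parameter `B` and batchsizes `m k`, where iteration `k` uses the samples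
`s k 0, …, s k (m k - 1)`. -/
def iterates {n : ℕ} {Ξ : Type*} (G : Euc n → Ξ → Euc n) (x₀ : Euc n) (L a B : ℝ)
    (m : ℕ → ℕ) (s : ℕ → ℕ → Ξ) : ℕ → Euc n × Euc n
  | 0 => (x₀, x₀)
  | k + 1 =>
    let y := (iterates G x₀ L a B m s k).1
    let z := (iterates G x₀ L a B m s k).2
    let α := stepα a L (k + 1)
    let A := stepA a L k
    let A' := stepA a L (k + 1)
    let x := A'⁻¹ • (A • y + α • z)
    let g := clip (miniBatch G x (m k) (s k)) (B / α)
    let z' := z - α • g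
    (A'⁻¹ • (A • y + α • z'), z')

/-- `ln (4 N / β)`. -/
def logN (N : ℕ) (β : ℝ) : ℝ := Real.log (4 * (N : ℝ) / β)

/-- The lower bound on the stepsize parameter `a` (with `C = √5`). -/
def aMin (N : ℕ) (β : ℝ) : ℝ :=
  max 1 (max (16 * logN N β / √5)
    (36 * (2 * logN N β + √(4 * logN N β ^ 2 + 2 * logN N β)) ^ 2))

/-- The clipping parameter `B = C R₀ / (8 ln (4 N / β))`. -/
def clipB (N : ℕ) (β R₀ : ℝ) : ℝ := √5 * R₀ / (8 * logN N β)

/-- The real-valued batchsize formula at iteration `k`. -/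
def batchReal (L σ R₀ a : ℝ) (N : ℕ) (β : ℝ) (k : ℕ) : ℝ :=
  max 1 (max (6000 * σ ^ 2 * stepα a L (k + 1) ^ 2 * N * logN N β / (√5 ^ 2 * R₀ ^ 2))
    (10368 * σ ^ 2 * stepα a L (k + 1) ^ 2 * N / (√5 ^ 2 * R₀ ^ 2)))

/-- The number of samples drawn at iteration `k`: the batchsize formula, rounded up. -/
def batchSize (L σ R₀ a : ℝ) (N : ℕ) (β : ℝ) (k : ℕ) : ℕ := ⌈batchReal L σ R₀ a N β k⌉₊

/-- The total number of stochastic gradients computed in `N` iterations. -/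
def oracleCalls (L σ R₀ a : ℝ) (N : ℕ) (β : ℝ) : ℕ :=
  ∑ k ∈ Finset.range N, batchSize L σ R₀ a N β k

/-- The output `y^N` of `N` iterations of `clipped-SSTM`, as a function of the outcome `ω`. -/
def output {n : ℕ} {Ξ Ω : Type*} (G : Euc n → Ξ → Euc n) (ξ : ℕ × ℕ → Ω → Ξ) (x₀ : Euc n)
    (L σ R₀ a : ℝ) (N : ℕ) (β : ℝ) (ω : Ω) : Euc n :=
  (iterates G x₀ L a (clipB N β R₀) (batchSize L σ R₀ a N β) (fun k i => ξ (k, i) ω) N).1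

/-- The conditions on the number of iterations `N`, the confidence parameter `β` and the stepsize
parameter `a`. -/
def Admissible (N : ℕ) (β a : ℝ) : Prop := 1 ≤ N ∧ 2 ≤ logN N β ∧ aMin N β ≤ a

/-- Medium batches: `a = N ln (4 N / β)`. -/
def aMedium (N : ℕ) (β : ℝ) : ℝ := N * logN N β

/-- Constant batches: `a = a₀ N ^ (3 / 2) √(ln (4 N / β))`. -/
def aConst (a₀ : ℝ) (N : ℕ) (β : ℝ) : ℝ := a₀ * (N : ℝ) ^ (3 / 2 : ℝ) * √(logN N β)

end ClippedSSTM

end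

/-!
The proof follows the potential `Φ_k = A_k (f (y^k) - f x^*) + ‖z^k - x^*‖² / 2`. By convexity and
smoothness, one step of the method raises it by at most `-⟪D, d⟫ + ‖D‖²`, where `D` is `α_{k+1}`
times the error of the clipped gradient estimator and `‖d‖ ≤ R` as long as `Φ_k ≤ R² / 2`, with
`R = √5 R₀`. On that event the clean gradient stays below half of the clipping level, so the
clipping bias is controlled by the variance and the error is bounded; hence the exponential moment
of the increment is `1 + O(variance)`, and the batchsizes make the product of these factors over
all `N` steps a small power of `4 N / β`. Stopping the process `exp (s Φ_k)` at the first exit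
above `R² / 2` and applying Markov's inequality bounds the exit probability by `β`. Without an exit,
`A_N (f (y^N) - f x^*) ≤ R² / 2`; the claims about `ε` then follow by inverting `N ↦ N / log N`.
-/

namespace ClippedSSTM

open scoped RealInnerProductSpace

section SmoothConvex

variable {E : Type*} [NormedAddCommGroup E] [InnerProductSpace ℝ E] [CompleteSpace E]
  {f : E → ℝ} {L : ℝ}

lemma hasDerivAt_lineMap {x y : E} {t : ℝ} (hf : DifferentiableAt ℝ f (AffineMap.lineMap x y t)) :
    HasDerivAt (fun s : ℝ => f (AffineMap.lineMap x y s))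
      ⟪gradient f (AffineMap.lineMap x y t), y - x⟫ t := by
  rw [inner_gradient_left]
  exact hf.hasFDerivAt.comp_hasDerivAt t AffineMap.hasDerivAt_lineMap

lemma add_inner_gradient_le {s : Set E} {x y : E} (hconv : ConvexOn ℝ s f) (hx : x ∈ s)
    (hy : y ∈ s) (hf : DifferentiableAt ℝ f x) : f x + ⟪gradient f x, y - x⟫ ≤ f y := by
  have hline : ConvexOn ℝ (AffineMap.lineMap x y ⁻¹' s)
      (fun t : ℝ => f (AffineMap.lineMap x y t)) :=
    hconv.comp_affineMap (AffineMap.lineMap x y)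
  have hderiv : HasDerivAt (fun t : ℝ => f (AffineMap.lineMap x y t)) ⟪gradient f x, y - x⟫ 0 := by
    simpa only [AffineMap.lineMap_apply_zero] using
      hasDerivAt_lineMap (x := x) (y := y) (t := 0) (by rwa [AffineMap.lineMap_apply_zero])
  have hslope := hline.le_slope_of_hasDerivAt (x := 0) (y := 1)
    (by rwa [Set.mem_preimage, AffineMap.lineMap_apply_zero])
    (by rwa [Set.mem_preimage, AffineMap.lineMap_apply_one]) one_pos hderiv
  rw [slope_def_field, AffineMap.lineMap_apply_zero, AffineMap.lineMap_apply_one, sub_zero,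
    div_one] at hslope
  linarith

lemma le_add_inner_gradient_add_sq (hf : Differentiable ℝ f)
    (hlip : ∀ x y, ‖gradient f x - gradient f y‖ ≤ L * ‖x - y‖) (x y : E) :
    f y ≤ f x + ⟪gradient f x, y - x⟫ + L / 2 * ‖y - x‖ ^ 2 := by
  let φ (t : ℝ) : ℝ := f (AffineMap.lineMap x y t) - t * ⟪gradient f x, y - x⟫ -
    L / 2 * ‖y - x‖ ^ 2 * t ^ 2
  have hφ (t : ℝ) : HasDerivAt φ (⟪gradient f (AffineMap.lineMap x y t) - gradient f x, y - x⟫ -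
      L * t * ‖y - x‖ ^ 2) t := by
    refine (((hasDerivAt_lineMap hf.differentiableAt).sub
      ((hasDerivAt_id t).mul_const _)).sub ((hasDerivAt_pow 2 t).const_mul _)).congr_deriv ?_
    rw [inner_sub_left]
    ring
  have hanti : AntitoneOn φ (Set.Icc 0 1) := by
    refine antitoneOn_of_hasDerivWithinAt_nonpos (convex_Icc 0 1)
      (fun t _ => (hφ t).continuousAt.continuousWithinAt) (fun t _ => (hφ t).hasDerivWithinAt)
      fun t ht => sub_nonpos.2 ?_
    rw [interior_Icc] at ht
    have hgrad : ‖gradient f (AffineMap.lineMap x y t) - gradient f x‖ ≤ L * (t * ‖y - x‖) := by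
      refine (hlip _ _).trans_eq ?_
      rw [← dist_eq_norm, dist_lineMap_left, Real.norm_of_nonneg ht.1.le, dist_comm, dist_eq_norm]
    calc _ ≤ ‖gradient f (AffineMap.lineMap x y t) - gradient f x‖ * ‖y - x‖ :=
          real_inner_le_norm _ _
      _ ≤ L * (t * ‖y - x‖) * ‖y - x‖ := by gcongr
      _ = L * t * ‖y - x‖ ^ 2 := by ring
  have hφ01 : φ 1 ≤ φ 0 :=
    hanti (Set.left_mem_Icc.2 zero_le_one) (Set.right_mem_Icc.2 zero_le_one) zero_le_one
  simp only [φ, AffineMap.lineMap_apply_zero, AffineMap.lineMap_apply_one] at hφ01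
  linarith

lemma norm_gradient_sq_le (hL : 0 < L) (hf : Differentiable ℝ f)
    (hlip : ∀ x y, ‖gradient f x - gradient f y‖ ≤ L * ‖x - y‖) {c : ℝ} (hc : ∀ x, c ≤ f x)
    (x : E) : ‖gradient f x‖ ^ 2 ≤ 2 * L * (f x - c) := by
  have hstep : f (x - L⁻¹ • gradient f x) ≤ f x - ‖gradient f x‖ ^ 2 / (2 * L) := by
    refine (le_add_inner_gradient_add_sq hf hlip x _).trans_eq ?_
    rw [sub_sub_cancel_left, inner_neg_right, inner_smul_right, real_inner_self_eq_norm_sq,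
      norm_neg, norm_smul, Real.norm_of_nonneg (inv_nonneg.2 hL.le)]
    field_simp
    ring
  have hdiv : ‖gradient f x‖ ^ 2 / (2 * L) ≤ f x - c := by linarith [hc (x - L⁻¹ • gradient f x)]
  rwa [div_le_iff₀' (by positivity)] at hdiv

lemma gradient_eq_zero_of_forall_le {x : E} (hx : ∀ y, f x ≤ f y) : gradient f x = 0 := by
  have hmin : IsLocalMin f x := Filter.Eventually.of_forall hx
  rw [gradient, hmin.fderiv_eq_zero, map_zero]

/-! ### Similar triangles -/

variable {A α : ℝ} {x y z : E}

lemma similarTriangles_descent (hf : Differentiable ℝ f)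
    (hlip : ∀ x y, ‖gradient f x - gradient f y‖ ≤ L * ‖x - y‖) (hA : 0 < A)
    (hstep : 2 * L * α ^ 2 ≤ A) (x v : E) :
    A * f (x - (A⁻¹ * α) • v) ≤ A * f x - ⟪α • gradient f x, v⟫ + ‖v‖ ^ 2 / 4 := by
  have hL : 2 * L * α ^ 2 / A ≤ 1 := (div_le_one hA).2 hstep
  have hdescent := le_add_inner_gradient_add_sq hf hlip x (x - (A⁻¹ * α) • v)
  rw [sub_sub_cancel_left, norm_neg, norm_smul, mul_pow, Real.norm_eq_abs, sq_abs,
    inner_neg_right, inner_smul_right] at hdescent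
  calc A * f (x - (A⁻¹ * α) • v)
      ≤ A * (f x + -(A⁻¹ * α * ⟪gradient f x, v⟫) + L / 2 * ((A⁻¹ * α) ^ 2 * ‖v‖ ^ 2)) := by
        gcongr
    _ = A * f x - ⟪α • gradient f x, v⟫ + 2 * L * α ^ 2 / A * (‖v‖ ^ 2 / 4) := by
        rw [real_inner_smul_left]
        field_simp
        ring
    _ ≤ A * f x - ⟪α • gradient f x, v⟫ + ‖v‖ ^ 2 / 4 := by
        gcongr
        exact mul_le_of_le_one_left (by positivity) hL

lemma similarTriangles_convex (hconv : ConvexOn ℝ Set.univ f) (hf : DifferentiableAt ℝ f x)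
    (hA : 0 ≤ A) (hα : 0 ≤ α) (hx : (A + α) • x = A • y + α • z) (xs : E) :
    (A + α) * f x ≤ A * f y + α * f xs + ⟪α • gradient f x, z - xs⟫ := by
  have hy := mul_le_mul_of_nonneg_left
    (add_inner_gradient_le hconv (Set.mem_univ x) (Set.mem_univ y) hf) hA
  have hxs := mul_le_mul_of_nonneg_left
    (add_inner_gradient_le hconv (Set.mem_univ x) (Set.mem_univ xs) hf) hα
  have hcomb : A • (y - x) + α • (xs - x) = -(α • (z - xs)) := by
    linear_combination (norm := module) (-1 : ℝ) • hx
  have hinner : A * ⟪gradient f x, y - x⟫ + α * ⟪gradient f x, xs - x⟫ =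
      -⟪α • gradient f x, z - xs⟫ := by
    rw [real_inner_smul_left, ← real_inner_smul_right, ← real_inner_smul_right,
      ← real_inner_smul_right, ← inner_add_right, hcomb, inner_neg_right]
  linarith

lemma similarTriangles_step (hconv : ConvexOn ℝ Set.univ f) (hf : Differentiable ℝ f)
    (hlip : ∀ x y, ‖gradient f x - gradient f y‖ ≤ L * ‖x - y‖) (hA : 0 ≤ A) (hα : 0 < α)
    (hstep : 2 * L * α ^ 2 ≤ A + α) (hx : (A + α) • x = A • y + α • z) (xs D : E) :
    (A + α) * (f (x - ((A + α)⁻¹ * α) • (α • gradient f x + D)) - f xs) +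
        ‖z - (α • gradient f x + D) - xs‖ ^ 2 / 2 ≤
      A * (f y - f xs) + ‖z - xs‖ ^ 2 / 2 + (-⟪D, z - xs⟫ + ‖D‖ ^ 2) := by
  have hA' : 0 < A + α := by positivity
  have hdescent := similarTriangles_descent hf hlip hA' hstep x (α • gradient f x + D)
  have hconvex := similarTriangles_convex hconv hf.differentiableAt hA hα.le hx xs
  have hdist : ‖z - (α • gradient f x + D) - xs‖ ^ 2 =
      ‖z - xs‖ ^ 2 - 2 * (⟪α • gradient f x, z - xs⟫ + ⟪D, z - xs⟫) +
        ‖α • gradient f x + D‖ ^ 2 := by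
    rw [sub_right_comm, norm_sub_sq_real, real_inner_comm, inner_add_left]
  have hself : ⟪α • gradient f x, α • gradient f x + D⟫ =
      ‖α • gradient f x‖ ^ 2 + ⟪α • gradient f x, D⟫ := by
    rw [inner_add_right, real_inner_self_eq_norm_sq]
  -- `3/4 ‖w + D‖² - ⟪w, w + D⟫ = ‖D‖² - ‖w - D‖² / 4`
  have hadd := norm_add_sq_real (α • gradient f x) D
  have hsub := norm_sub_sq_real (α • gradient f x) D
  linarith [sq_nonneg ‖α • gradient f x - D‖]

end SmoothConvex

/-! ### Clipping -/

section Clipping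

variable {n : ℕ} {v X : Euc n} {B : ℝ}

lemma clip_of_norm_le (h : ‖v‖ ≤ B) : clip v B = v := by
  rcases eq_or_ne v 0 with rfl | hv
  · exact smul_zero _
  · rw [clip, min_eq_left ((one_le_div (norm_pos_iff.2 hv)).2 h), one_smul]

lemma clip_of_le_norm (hv : 0 < ‖v‖) (h : B ≤ ‖v‖) : clip v B = (B / ‖v‖) • v := by
  rw [clip, min_eq_right ((div_le_one hv).2 h)]

lemma norm_clip_le (hB : 0 ≤ B) : ‖clip v B‖ ≤ B := by
  rcases le_or_gt ‖v‖ B with h | h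
  · rwa [clip_of_norm_le h]
  · have hv : 0 < ‖v‖ := hB.trans_lt h
    rw [clip_of_le_norm hv h.le, norm_smul, Real.norm_of_nonneg (by positivity),
      div_mul_cancel₀ _ hv.ne']

lemma smul_clip {α : ℝ} (hα : 0 < α) : α • clip v (B / α) = clip (α • v) B := by
  rw [clip, clip, norm_smul, Real.norm_of_nonneg hα.le, div_div, smul_smul, smul_smul, mul_comm]

lemma measurable_clip (B : ℝ) : Measurable fun v : Euc n => clip v B :=
  (measurable_const.min (measurable_const.div measurable_norm)).smul measurable_id

lemma norm_clip_sub_le (hB : 0 ≤ B) (hX : ‖X‖ ≤ B) : ‖clip v B - X‖ ≤ ‖v - X‖ := by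
  rcases le_or_gt ‖v‖ B with h | h
  · rw [clip_of_norm_le h]
  have hv : 0 < ‖v‖ := hB.trans_lt h
  have hc : 0 ≤ 1 - B / ‖v‖ := sub_nonneg.2 ((div_le_one hv).2 h.le)
  have hinner : ⟪v, X⟫ ≤ ‖v‖ * B := (real_inner_le_norm v X).trans (by gcongr)
  rw [clip_of_le_norm hv h.le]
  refine (sq_le_sq₀ (norm_nonneg _) (norm_nonneg _)).1 ?_
  calc ‖(B / ‖v‖) • v - X‖ ^ 2 = B ^ 2 - 2 * ⟪v, X⟫ + ‖X‖ ^ 2 + 2 * ((1 - B / ‖v‖) * ⟪v, X⟫) := by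
        rw [norm_sub_sq_real, norm_smul, real_inner_smul_left, Real.norm_of_nonneg (by positivity),
          div_mul_cancel₀ _ hv.ne']
        ring
    _ ≤ B ^ 2 - 2 * ⟪v, X⟫ + ‖X‖ ^ 2 + 2 * ((1 - B / ‖v‖) * (‖v‖ * B)) := by gcongr
    _ = ‖v - X‖ ^ 2 - (‖v‖ - B) ^ 2 := by
        rw [norm_sub_sq_real]
        field_simp
        ring
    _ ≤ ‖v - X‖ ^ 2 := sub_le_self _ (sq_nonneg _)

lemma norm_clip_sub_self_le (hB : 0 < B) (hX : ‖X‖ ≤ B / 2) :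
    ‖clip v B - v‖ ≤ ‖v - X‖ ^ 2 / (2 * B) := by
  rcases le_or_gt ‖v‖ B with h | h
  · rw [clip_of_norm_le h, sub_self, norm_zero]
    positivity
  have hv : 0 < ‖v‖ := hB.trans h
  have hexcess : ‖clip v B - v‖ = ‖v‖ - B := by
    have hc : B / ‖v‖ - 1 ≤ 0 := sub_nonpos.2 ((div_le_one hv).2 h.le)
    have hsub : (B / ‖v‖) • v - v = (B / ‖v‖ - 1) • v := by rw [sub_smul, one_smul]
    rw [clip_of_le_norm hv h.le, hsub, norm_smul, Real.norm_of_nonpos hc]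
    field_simp
    ring
  have hdist : ‖v‖ - B / 2 ≤ ‖v - X‖ := by linarith [norm_sub_norm_le v X]
  rw [hexcess, le_div_iff₀ (by positivity)]
  nlinarith [sq_nonneg (‖v - X‖ - B)]

end Clipping

/-! ### Exponential moment of the clipping error -/

/-- The exponent `s R / (2 B) + s + 2 s² R²` which, multiplied by the variance of an unbiased
estimator clipped at level `B`, bounds the log-moment of `s (-⟪D, d⟫ + ‖D‖²)`, where `D` is the
error of the clipped estimator and `‖d‖ ≤ R`. The summands come from the bias of clipping, from
`‖D‖²`, and from the second-order term of the exponential. -/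
noncomputable def noiseExponent (R B s : ℝ) : ℝ := s * R / (2 * B) + s + 2 * s ^ 2 * R ^ 2

lemma noiseExponent_nonneg {R B s : ℝ} (hR : 0 ≤ R) (hB : 0 ≤ B) (hs : 0 ≤ s) :
    0 ≤ noiseExponent R B s := by
  unfold noiseExponent
  positivity

section ClipError

variable {n : ℕ} {X d v : Euc n} {B R s : ℝ}

lemma neg_inner_clip_error_le (hB : 0 < B) (hX : ‖X‖ ≤ B / 2) (hd : ‖d‖ ≤ R) :
    -⟪clip v B - X, d⟫ ≤ R / (2 * B) * ‖v - X‖ ^ 2 - ⟪d, v - X⟫ := by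
  have hsplit : ⟪clip v B - X, d⟫ = ⟪clip v B - v, d⟫ + ⟪d, v - X⟫ := by
    rw [real_inner_comm (v - X) d, ← inner_add_left, sub_add_sub_cancel]
  have hbias : -⟪clip v B - v, d⟫ ≤ R / (2 * B) * ‖v - X‖ ^ 2 := by
    calc -⟪clip v B - v, d⟫ ≤ ‖clip v B - v‖ * ‖d‖ :=
          (neg_le_abs _).trans (abs_real_inner_le_norm _ _)
      _ ≤ ‖v - X‖ ^ 2 / (2 * B) * R := by
          gcongr
          exact norm_clip_sub_self_le hB hX
      _ = R / (2 * B) * ‖v - X‖ ^ 2 := by ring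
  linarith

lemma abs_clip_error_le (hB : 0 ≤ B) (hX : ‖X‖ ≤ B / 2) (hd : ‖d‖ ≤ R) (hBR : 16 * B ≤ R) :
    |-⟪clip v B - X, d⟫ + ‖clip v B - X‖ ^ 2| ≤ 35 / 32 * R * ‖clip v B - X‖ := by
  have hD : ‖clip v B - X‖ ≤ 3 / 2 * B := by
    linarith [norm_sub_le (clip v B) X, norm_clip_le (v := v) hB]
  calc |-⟪clip v B - X, d⟫ + ‖clip v B - X‖ ^ 2|
      ≤ |-⟪clip v B - X, d⟫| + |‖clip v B - X‖ ^ 2| := abs_add_le _ _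
    _ = |⟪clip v B - X, d⟫| + ‖clip v B - X‖ * ‖clip v B - X‖ := by
        rw [abs_neg, abs_sq, sq]
    _ ≤ ‖clip v B - X‖ * R + 3 / 32 * R * ‖clip v B - X‖ := by
        gcongr
        · exact (abs_real_inner_le_norm _ _).trans (by gcongr)
        · linarith
    _ = 35 / 32 * R * ‖clip v B - X‖ := by ring

lemma exp_clip_error_le (hB : 0 < B) (hX : ‖X‖ ≤ B / 2) (hd : ‖d‖ ≤ R) (hBR : 16 * B ≤ R)
    (hs : 0 ≤ s) (hsRB : s * R * B ≤ 3 / 8) :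
    Real.exp (s * (-⟪clip v B - X, d⟫ + ‖clip v B - X‖ ^ 2)) ≤
      1 + noiseExponent R B s * ‖v - X‖ ^ 2 - s * ⟪d, v - X⟫ := by
  set D := clip v B - X
  have hR : 0 ≤ R := (norm_nonneg d).trans hd
  have hDB : ‖D‖ ≤ 3 / 2 * B := by
    linarith [norm_sub_le (clip v B) X, norm_clip_le (v := v) hB.le]
  have hDv : ‖D‖ ^ 2 ≤ ‖v - X‖ ^ 2 := by
    gcongr
    exact norm_clip_sub_le hB.le (by linarith)
  have habs : |s * (-⟪D, d⟫ + ‖D‖ ^ 2)| ≤ s * (35 / 32 * R * ‖D‖) := by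
    rw [abs_mul, abs_of_nonneg hs]
    gcongr
    exact abs_clip_error_le hB.le hX hd hBR
  have hle_one : |s * (-⟪D, d⟫ + ‖D‖ ^ 2)| ≤ 1 := by
    calc _ ≤ s * (35 / 32 * R * (3 / 2 * B)) := habs.trans (by gcongr)
      _ ≤ 1 := by linarith
  have hexp := (abs_le.1 (Real.abs_exp_sub_one_sub_id_le hle_one)).2
  have hlinear : s * (-⟪D, d⟫ + ‖D‖ ^ 2) ≤
      (s * R / (2 * B) + s) * ‖v - X‖ ^ 2 - s * ⟪d, v - X⟫ := by
    calc s * (-⟪D, d⟫ + ‖D‖ ^ 2)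
        ≤ s * (R / (2 * B) * ‖v - X‖ ^ 2 - ⟪d, v - X⟫ + ‖v - X‖ ^ 2) := by
          gcongr
          exact neg_inner_clip_error_le hB hX hd
      _ = _ := by ring
  have hsquare : (s * (-⟪D, d⟫ + ‖D‖ ^ 2)) ^ 2 ≤ 2 * s ^ 2 * R ^ 2 * ‖v - X‖ ^ 2 := by
    calc (s * (-⟪D, d⟫ + ‖D‖ ^ 2)) ^ 2 ≤ (s * (35 / 32 * R * ‖D‖)) ^ 2 :=
          sq_le_sq.2 (habs.trans (le_abs_self _))
      _ = (35 / 32) ^ 2 * s ^ 2 * R ^ 2 * ‖D‖ ^ 2 := by ring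
      _ ≤ 2 * s ^ 2 * R ^ 2 * ‖v - X‖ ^ 2 := by gcongr; norm_num
  rw [noiseExponent]
  linarith

end ClipError

lemma lintegral_exp_clip_error_le {n : ℕ} {Ω : Type*} [MeasurableSpace Ω] {μ : Measure Ω}
    [IsProbabilityMeasure μ] {Y : Ω → Euc n} {X d : Euc n} {v B R s : ℝ} (hi : Integrable Y μ)
    (hmean : ∫ ω, Y ω ∂μ = X) (hsq : Integrable (fun ω => ‖Y ω - X‖ ^ 2) μ)
    (hv : ∫ ω, ‖Y ω - X‖ ^ 2 ∂μ ≤ v) (hB : 0 < B) (hX : ‖X‖ ≤ B / 2) (hd : ‖d‖ ≤ R)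
    (hBR : 16 * B ≤ R) (hs : 0 ≤ s) (hsRB : s * R * B ≤ 3 / 8) :
    ∫⁻ ω, ENNReal.ofReal
        (Real.exp (s * (-⟪clip (Y ω) B - X, d⟫ + ‖clip (Y ω) B - X‖ ^ 2))) ∂μ ≤
      ENNReal.ofReal (Real.exp (noiseExponent R B s * v)) := by
  have hpointwise (ω : Ω) := exp_clip_error_le (v := Y ω) hB hX hd hBR hs hsRB
  have hκ : 0 ≤ noiseExponent R B s :=
    noiseExponent_nonneg ((norm_nonneg d).trans hd) hB.le hs
  have hcentred : Integrable (fun ω => Y ω - X) μ := hi.sub (integrable_const X)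
  have hmean0 : ∫ ω, ⟪d, Y ω - X⟫ ∂μ = 0 := by
    rw [integral_inner hcentred, integral_sub hi (integrable_const X), hmean, integral_const,
      probReal_univ, one_smul, sub_self, inner_zero_right]
  have hvar : Integrable (fun ω => 1 + noiseExponent R B s * ‖Y ω - X‖ ^ 2) μ :=
    (integrable_const 1).add (hsq.const_mul _)
  have hlin : Integrable (fun ω => s * ⟪d, Y ω - X⟫) μ := (hcentred.const_inner d).const_mul s
  have hbound : Integrable
      (fun ω => 1 + noiseExponent R B s * ‖Y ω - X‖ ^ 2 - s * ⟪d, Y ω - X⟫) μ := hvar.sub hlin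
  refine (lintegral_mono fun ω => ENNReal.ofReal_le_ofReal (hpointwise ω)).trans ?_
  rw [← ofReal_integral_eq_lintegral_ofReal hbound
    (Filter.Eventually.of_forall fun ω => (Real.exp_pos _).le.trans (hpointwise ω))]
  refine ENNReal.ofReal_le_ofReal ?_
  calc ∫ ω, 1 + noiseExponent R B s * ‖Y ω - X‖ ^ 2 - s * ⟪d, Y ω - X⟫ ∂μ
      = noiseExponent R B s * ∫ ω, ‖Y ω - X‖ ^ 2 ∂μ + 1 := by
        rw [integral_sub hvar hlin, integral_add (integrable_const 1) (hsq.const_mul _),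
          integral_const_mul, integral_const_mul, hmean0, integral_const, probReal_univ, one_smul]
        ring
    _ ≤ noiseExponent R B s * v + 1 := by gcongr
    _ ≤ Real.exp (noiseExponent R B s * v) := Real.add_one_le_exp _

/-! ### Mini-batches -/

lemma integral_norm_sum_sq {E Ω ι : Type*} [NormedAddCommGroup E] [InnerProductSpace ℝ E]
    [CompleteSpace E] [MeasurableSpace E] [BorelSpace E] [MeasurableSpace Ω] {μ : Measure Ω}
    [IsFiniteMeasure μ] {s : Finset ι} {w : ι → Ω → E} (hw : ∀ i ∈ s, MemLp (w i) 2 μ)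
    (hmean : ∀ i ∈ s, ∫ ω, w i ω ∂μ = 0)
    (hind : (s : Set ι).Pairwise fun i j => IndepFun (w i) (w j) μ) :
    ∫ ω, ‖∑ i ∈ s, w i ω‖ ^ 2 ∂μ = ∑ i ∈ s, ∫ ω, ‖w i ω‖ ^ 2 ∂μ := by
  have horth : ∀ i ∈ s, ∀ j ∈ s, i ≠ j → ∫ ω, ⟪w i ω, w j ω⟫ ∂μ = 0 := fun i hi j hj hij => by
    refine ((hind hi hj hij).integral_bilin ((hw i hi).integrable one_le_two)
      ((hw j hj).integrable one_le_two) (innerSL ℝ)).trans ?_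
    rw [hmean i hi, map_zero, zero_apply]
  have hint : ∀ i ∈ s, ∀ j ∈ s, Integrable (fun ω => ⟪w i ω, w j ω⟫) μ := fun i hi j hj => by
    rcases eq_or_ne i j with rfl | hij
    · simpa only [real_inner_self_eq_norm_sq] using (hw i hi).integrable_norm_pow two_ne_zero
    · exact (hind hi hj hij).integrable_bilin ((hw i hi).integrable one_le_two)
        ((hw j hj).integrable one_le_two) (innerSL ℝ)
  simp only [← real_inner_self_eq_norm_sq, sum_inner, inner_sum]
  rw [integral_finsetSum _ fun j hj => integrable_finsetSum _ fun i hi => hint i hi j hj]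
  refine Finset.sum_congr rfl fun j hj => ?_
  rw [integral_finsetSum _ fun i hi => hint i hi j hj,
    Finset.sum_eq_single_of_mem j hj fun i hi => horth i hi j hj]

lemma miniBatch_sub {n : ℕ} {Ξ : Type*} {m : ℕ} (hm : m ≠ 0) (G : Euc n → Ξ → Euc n) (x c : Euc n)
    (s : ℕ → Ξ) :
    miniBatch G x m s - c = (m : ℝ)⁻¹ • ∑ i ∈ Finset.range m, (G x (s i) - c) := by
  rw [miniBatch, Finset.sum_sub_distrib, Finset.sum_const, Finset.card_range, smul_sub,
    ← Nat.cast_smul_eq_nsmul ℝ, inv_smul_smul₀ (Nat.cast_ne_zero.2 hm)]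

section StochasticGradient

variable {n : ℕ} {Ξ Ω : Type*} [MeasurableSpace Ξ] [MeasurableSpace Ω] {f : Euc n → ℝ}
  {P : Measure Ξ} {G : Euc n → Ξ → Euc n} {σ : ℝ}

lemma IsStochasticGradient.measurable_right (hG : IsStochasticGradient f P G σ) (x : Euc n) :
    Measurable (G x) :=
  hG.measurable.comp measurable_prodMk_left

lemma IsStochasticGradient.memLp_sub (hG : IsStochasticGradient f P G σ) (x : Euc n) :
    MemLp (fun ζ => G x ζ - gradient f x) 2 P :=
  (memLp_two_iff_integrable_sq_norm
    ((hG.measurable_right x).sub_const _).aestronglyMeasurable).2 (hG.integrable_sq x)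

lemma IsStochasticGradient.comp_measurePreserving {μ : Measure Ω} {T : Ω → Ξ}
    (hG : IsStochasticGradient f P G σ) (hT : MeasurePreserving T μ P) :
    IsStochasticGradient f μ (fun x ω => G x (T ω)) σ where
  measurable := hG.measurable.comp (measurable_fst.prodMk (hT.measurable.comp measurable_snd))
  integrable x := hT.integrable_comp_of_integrable (hG.integrable x)
  unbiased x := by
    rw [← hG.unbiased x, ← hT.map_eq, integral_map hT.measurable.aemeasurable
      (hG.measurable_right x).aestronglyMeasurable]
  integrable_sq x := hT.integrable_comp_of_integrable (hG.integrable_sq x)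
  variance_le x := by
    refine le_of_eq_of_le ?_ (hG.variance_le x)
    rw [← hT.map_eq, integral_map hT.measurable.aemeasurable
      (((hG.measurable_right x).sub_const _).norm.pow_const 2).aestronglyMeasurable]

lemma measurable_miniBatch (hG : Measurable (Function.uncurry G)) (m : ℕ) :
    Measurable fun q : Euc n × (ℕ → Ξ) => miniBatch G q.1 m q.2 := by
  have hterm (i : ℕ) : Measurable fun q : Euc n × (ℕ → Ξ) => G q.1 (q.2 i) :=
    hG.comp (measurable_fst.prodMk ((measurable_pi_apply i).comp measurable_snd))
  exact (Finset.measurable_fun_sum _ fun i _ => hterm i).const_smul (m : ℝ)⁻¹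

lemma IsStochasticGradient.miniBatch {μ : Measure Ω} [IsProbabilityMeasure μ] {ζ : ℕ → Ω → Ξ}
    (hG : IsStochasticGradient f P G σ) (hζ : ∀ i, MeasurePreserving (ζ i) μ P)
    (hind : Pairwise fun i j => IndepFun (ζ i) (ζ j) μ) {m : ℕ} (hm : m ≠ 0) :
    IsStochasticGradient f μ (fun x ω => miniBatch G x m (fun i => ζ i ω)) (σ / √m) := by
  have hGi (i : ℕ) := hG.comp_measurePreserving (hζ i)
  have hcentred (x : Euc n) (i : ℕ) : ∫ ω, (G x (ζ i ω) - gradient f x) ∂μ = 0 := by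
    rw [integral_sub ((hGi i).integrable x) (integrable_const _), (hGi i).unbiased x,
      integral_const, probReal_univ, one_smul, sub_self]
  have hnorm (x : Euc n) (ω : Ω) :
      ‖ClippedSSTM.miniBatch G x m (fun i => ζ i ω) - gradient f x‖ ^ 2 =
        ((m : ℝ)⁻¹) ^ 2 * ‖∑ i ∈ Finset.range m, (G x (ζ i ω) - gradient f x)‖ ^ 2 := by
    rw [miniBatch_sub hm, norm_smul, mul_pow, Real.norm_eq_abs, sq_abs]
  refine ⟨?_, fun x => ?_, fun x => ?_, fun x => ?_, fun x => ?_⟩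
  · exact (measurable_miniBatch hG.measurable m).comp (measurable_fst.prodMk
      (measurable_pi_lambda _ fun i => (hζ i).measurable.comp measurable_snd))
  · exact (integrable_finsetSum _ fun i _ => (hGi i).integrable x).smul (m : ℝ)⁻¹
  · simp only [ClippedSSTM.miniBatch]
    rw [integral_smul, integral_finsetSum _ fun i _ => (hGi i).integrable x,
      Finset.sum_congr rfl fun i _ => (hGi i).unbiased x, Finset.sum_const, Finset.card_range,
      ← Nat.cast_smul_eq_nsmul ℝ, inv_smul_smul₀ (Nat.cast_ne_zero.2 hm)]
  · simp only [hnorm]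
    exact (memLp_finsetSum _ fun i _ => (hGi i).memLp_sub x).integrable_norm_pow two_ne_zero
      |>.const_mul _
  · simp only [hnorm]
    rw [integral_const_mul, integral_norm_sum_sq (fun i _ => (hGi i).memLp_sub x)
      (fun i _ => hcentred x i) fun i _ j _ hij => (hind hij).comp
        ((hG.measurable_right x).sub_const _) ((hG.measurable_right x).sub_const _)]
    calc ((m : ℝ)⁻¹) ^ 2 * ∑ i ∈ Finset.range m, ∫ ω, ‖G x (ζ i ω) - gradient f x‖ ^ 2 ∂μ
        ≤ ((m : ℝ)⁻¹) ^ 2 * ∑ i ∈ Finset.range m, σ ^ 2 := by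
          gcongr with i
          exact (hGi i).variance_le x
      _ = (σ / √m) ^ 2 := by
          rw [Finset.sum_const, Finset.card_range, nsmul_eq_mul, div_pow,
            Real.sq_sqrt m.cast_nonneg]
          field_simp

end StochasticGradient

/-! ### Stepsizes -/

section Stepsizes

variable {a L : ℝ}

lemma stepA_eq (a L : ℝ) (k : ℕ) : stepA a L k = (k : ℝ) * (k + 3) / (4 * a * L) := by
  induction k with
  | zero => simp only [stepA, Nat.cast_zero, zero_mul, zero_div]
  | succ k ih =>
    rw [stepA, ih, stepα]
    push_cast
    field_simp
    ring

lemma stepα_succ_pos (ha : 0 < a) (hL : 0 < L) (k : ℕ) : 0 < stepα a L (k + 1) := by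
  rw [stepα]
  positivity

lemma stepA_nonneg (ha : 0 ≤ a) (hL : 0 ≤ L) (k : ℕ) : 0 ≤ stepA a L k := by
  rw [stepA_eq]
  positivity

lemma stepA_succ_pos (ha : 0 < a) (hL : 0 < L) (k : ℕ) : 0 < stepA a L (k + 1) := by
  rw [stepA_eq]
  positivity

lemma mul_stepα_sq_le_stepA_succ (ha : 0 < a) (hL : 0 < L) (k : ℕ) :
    a * L * stepα a L (k + 1) ^ 2 ≤ stepA a L (k + 1) := by
  have hα : a * L * stepα a L (k + 1) ^ 2 = ((k : ℝ) + 2) ^ 2 / (4 * a * L) := by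
    rw [stepα]
    field_simp
    norm_num
  rw [hα, stepA_eq]
  gcongr
  push_cast
  nlinarith

lemma mul_stepα_sq_le_stepA (ha : 0 < a) (hL : 0 < L) {k : ℕ} (hk : 1 ≤ k) :
    4 * a * L * stepα a L (k + 1) ^ 2 ≤ 9 * stepA a L k := by
  have hk' : (1 : ℝ) ≤ k := Nat.one_le_cast.2 hk
  have hα : 4 * a * L * stepα a L (k + 1) ^ 2 = 4 * ((k : ℝ) + 2) ^ 2 / (4 * a * L) := by
    rw [stepα]
    field_simp
    norm_num
  rw [hα, stepA_eq, mul_div_assoc']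
  refine div_le_div_of_nonneg_right ?_ (by positivity)
  nlinarith

end Stepsizes

/-! ### One iteration -/

/-- The average of `y` and `z` with weights `A_k / A_{k+1}` and `α_{k+1} / A_{k+1}`. Applied to
`(y^k, z^k)` it is the point `x^{k+1}` at which the gradient is queried, applied to
`(y^k, z^{k+1})` it is `y^{k+1}`. -/
noncomputable def weightedAvg {n : ℕ} (L a : ℝ) (k : ℕ) (y z : Euc n) : Euc n :=
  (stepA a L (k + 1))⁻¹ • (stepA a L k • y + stepα a L (k + 1) • z)

/-- One iteration of `clipped-SSTM` from the state `p = (y^k, z^k)`, where `g` is the gradient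
estimate at the query point. -/
noncomputable def advance {n : ℕ} (L a B : ℝ) (k : ℕ) (p : Euc n × Euc n) (g : Euc n) :
    Euc n × Euc n :=
  let z' := p.2 - stepα a L (k + 1) • clip g (B / stepα a L (k + 1))
  (weightedAvg L a k p.1 z', z')

section Iteration

variable {n : ℕ} {L a B : ℝ} {k : ℕ} {y z : Euc n}

lemma smul_weightedAvg (ha : 0 < a) (hL : 0 < L) (y z : Euc n) :
    (stepA a L k + stepα a L (k + 1)) • weightedAvg L a k y z =
      stepA a L k • y + stepα a L (k + 1) • z :=
  smul_inv_smul₀ (stepA_succ_pos ha hL k).ne' _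

lemma weightedAvg_sub (y z v : Euc n) :
    weightedAvg L a k y (z - v) = weightedAvg L a k y z -
      ((stepA a L k + stepα a L (k + 1))⁻¹ * stepα a L (k + 1)) • v := by
  rw [weightedAvg, weightedAvg, stepA]
  module

lemma weightedAvg_sub_left (ha : 0 < a) (hL : 0 < L) (y z : Euc n) :
    weightedAvg L a k y z - y = (stepα a L (k + 1) / stepA a L (k + 1)) • (z - y) := by
  have hA := (stepA_succ_pos ha hL k).ne'
  rw [← smul_right_inj hA, smul_sub, smul_smul, mul_div_cancel₀ _ hA]
  rw [stepA, smul_weightedAvg ha hL]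
  module

lemma weightedAvg_mem {s : Set (Euc n)} (hs : Convex ℝ s) (ha : 0 < a) (hL : 0 < L) (hy : y ∈ s)
    (hz : z ∈ s) : weightedAvg L a k y z ∈ s := by
  have hA := stepA_succ_pos ha hL k
  have hmem := hs hy hz (div_nonneg (stepA_nonneg ha.le hL.le k) hA.le)
    (div_nonneg (stepα_succ_pos ha hL k).le hA.le) (by rw [← add_div]; exact div_self hA.ne')
  rwa [div_eq_inv_mul, div_eq_inv_mul, mul_smul, mul_smul, ← smul_add] at hmem

lemma measurable_weightedAvg (L a : ℝ) (k : ℕ) :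
    Measurable fun q : Euc n × Euc n => weightedAvg L a k q.1 q.2 := by
  unfold weightedAvg
  fun_prop

lemma measurable_advance (L a B : ℝ) (k : ℕ) :
    Measurable fun q : (Euc n × Euc n) × Euc n => advance L a B k q.1 q.2 := by
  have hclip : Measurable fun q : (Euc n × Euc n) × Euc n =>
      clip q.2 (B / stepα a L (k + 1)) := (measurable_clip _).comp measurable_snd
  have hz : Measurable fun q : (Euc n × Euc n) × Euc n =>
      q.1.2 - stepα a L (k + 1) • clip q.2 (B / stepα a L (k + 1)) := by fun_prop
  exact ((measurable_weightedAvg L a k).comp (measurable_fst.fst.prodMk hz)).prodMk hz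

variable {Ξ Ω : Type*} {G : Euc n → Ξ → Euc n} {x₀ : Euc n} {m : ℕ → ℕ}

lemma iterates_succ (G : Euc n → Ξ → Euc n) (x₀ : Euc n) (L a B : ℝ) (m : ℕ → ℕ)
    (s : ℕ → ℕ → Ξ) (k : ℕ) :
    iterates G x₀ L a B m s (k + 1) = advance L a B k (iterates G x₀ L a B m s k)
      (miniBatch G (weightedAvg L a k (iterates G x₀ L a B m s k).1
        (iterates G x₀ L a B m s k).2) (m k) (s k)) :=
  rfl

lemma iterates_fst_mem {S : Set (Euc n)} (hS : Convex ℝ S) (ha : 0 < a) (hL : 0 < L)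
    {s : ℕ → ℕ → Ξ} (hz : ∀ i ≤ k, (iterates G x₀ L a B m s i).2 ∈ S) :
    (iterates G x₀ L a B m s k).1 ∈ S := by
  induction k with
  | zero => exact hz 0 le_rfl
  | succ k ih =>
    exact weightedAvg_mem hS ha hL (ih fun i hi => hz i (hi.trans k.le_succ)) (hz (k + 1) le_rfl)

variable [MeasurableSpace Ξ] {mΩ : MeasurableSpace Ω}

lemma measurable_advance_miniBatch (hG : Measurable (Function.uncurry G)) (L a B : ℝ) (k m : ℕ) :
    Measurable fun q : (Euc n × Euc n) × (ℕ → Ξ) =>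
      advance L a B k q.1 (miniBatch G (weightedAvg L a k q.1.1 q.1.2) m q.2) := by
  have hquery : Measurable fun q : (Euc n × Euc n) × (ℕ → Ξ) => weightedAvg L a k q.1.1 q.1.2 :=
    (measurable_weightedAvg L a k).comp measurable_fst
  have hbatch : Measurable fun q : (Euc n × Euc n) × (ℕ → Ξ) =>
      miniBatch G (weightedAvg L a k q.1.1 q.1.2) m q.2 :=
    (measurable_miniBatch hG m).comp (hquery.prodMk measurable_snd)
  simpa only [Function.comp_def] using
    (measurable_advance L a B k).comp (measurable_fst.prodMk hbatch)

lemma measurable_iterates (hG : Measurable (Function.uncurry G)) {ξ : ℕ × ℕ → Ω → Ξ}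
    (hξ : ∀ p : ℕ × ℕ, p.1 < k → Measurable (ξ p)) :
    Measurable fun ω => iterates G x₀ L a B m (fun j i => ξ (j, i) ω) k := by
  induction k with
  | zero => exact measurable_const
  | succ k ih =>
    have hstate : Measurable fun ω =>
        (iterates G x₀ L a B m (fun j i => ξ (j, i) ω) k, fun i => ξ (k, i) ω) :=
      (ih fun p hp => hξ p (hp.trans k.lt_succ_self)).prodMk
        (measurable_pi_lambda _ fun i => hξ (k, i) k.lt_succ_self)
    simp only [iterates_succ]
    simpa only [Function.comp_def] using
      (measurable_advance_miniBatch hG L a B k (m k)).comp hstate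

end Iteration

/-! ### The potential -/

/-- The potential `A_k (f (y^k) - f x^*) + ‖z^k - x^*‖² / 2` of the state `p = (y^k, z^k)`, whose
drift along the iteration is controlled. -/
noncomputable def potential {n : ℕ} (f : Euc n → ℝ) (xs : Euc n) (L a : ℝ) (k : ℕ)
    (p : Euc n × Euc n) : ℝ :=
  stepA a L k * (f p.1 - f xs) + ‖p.2 - xs‖ ^ 2 / 2

section Potential

variable {n : ℕ} {f : Euc n → ℝ} {xs : Euc n} {L a B R : ℝ} {k : ℕ} {p : Euc n × Euc n}

lemma measurable_potential (hf : Continuous f) (xs : Euc n) (L a : ℝ) (k : ℕ) :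
    Measurable (potential f xs L a k) := by
  have hfm := hf.measurable
  unfold potential
  fun_prop

lemma norm_snd_sub_le_of_potential_le (hL : 0 ≤ L) (ha : 0 ≤ a) (hxs : ∀ x, f xs ≤ f x)
    (hR : 0 ≤ R) (hp : potential f xs L a k p ≤ R ^ 2 / 2) : ‖p.2 - xs‖ ≤ R := by
  have hgap : 0 ≤ stepA a L k * (f p.1 - f xs) :=
    mul_nonneg (stepA_nonneg ha hL k) (sub_nonneg.2 (hxs p.1))
  rw [potential] at hp
  exact (sq_le_sq₀ (norm_nonneg _) hR).1 (by linarith)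

lemma stepA_mul_sub_le_of_potential_le {c : ℝ} (hp : potential f xs L a k p ≤ c) :
    stepA a L k * (f p.1 - f xs) ≤ c := by
  rw [potential] at hp
  linarith [sq_nonneg ‖p.2 - xs‖]

lemma potential_advance_le (hL : 0 < L) (hconv : ConvexOn ℝ Set.univ f) (hf : LSmooth f L)
    (ha : 2 ≤ a) (p : Euc n × Euc n) (g : Euc n) :
    potential f xs L a (k + 1) (advance L a B k p g) ≤ potential f xs L a k p +
      (-⟪clip (stepα a L (k + 1) • g) B -
          stepα a L (k + 1) • gradient f (weightedAvg L a k p.1 p.2), p.2 - xs⟫ +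
        ‖clip (stepα a L (k + 1) • g) B -
          stepα a L (k + 1) • gradient f (weightedAvg L a k p.1 p.2)‖ ^ 2) := by
  have ha0 : 0 < a := by linarith
  have hα := stepα_succ_pos ha0 hL k
  have hstep : 2 * L * stepα a L (k + 1) ^ 2 ≤ stepA a L k + stepα a L (k + 1) :=
    le_trans (by gcongr) (mul_stepα_sq_le_stepA_succ ha0 hL k)
  have hdrift := similarTriangles_step hconv hf.1 hf.2 (stepA_nonneg ha0.le hL.le k) hα hstep
    (smul_weightedAvg ha0 hL p.1 p.2) xs (clip (stepα a L (k + 1) • g) B -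
      stepα a L (k + 1) • gradient f (weightedAvg L a k p.1 p.2))
  rw [add_sub_cancel, ← weightedAvg_sub, ← smul_clip hα] at hdrift
  rwa [← smul_clip hα]

lemma stepα_mul_norm_gradient_le (hL : 0 < L) (ha : 1 ≤ a) (hR : 0 ≤ R) (hf : LSmooth f L)
    (hxs : ∀ x, f xs ≤ f x) {y : Euc n} (hy : ‖y - xs‖ ≤ R)
    (hgap : stepA a L k * (f y - f xs) ≤ R ^ 2 / 2) :
    stepα a L (k + 1) * ‖gradient f y‖ ≤ R * (3 / (2 * √a)) := by
  have ha0 : 0 < a := by linarith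
  have hsq : (R * (3 / (2 * √a))) ^ 2 = 9 * R ^ 2 / (4 * a) := by
    rw [mul_pow, div_pow, mul_pow, Real.sq_sqrt ha0.le]
    ring
  refine (sq_le_sq₀ (mul_nonneg (stepα_succ_pos ha0 hL k).le (norm_nonneg _))
    (by positivity)).1 ?_
  rw [hsq, le_div_iff₀ (by positivity)]
  rcases Nat.eq_zero_or_pos k with rfl | hk
  · have hgrad : ‖gradient f y‖ ≤ L * R := by
      have hlip := hf.2 y xs
      rw [gradient_eq_zero_of_forall_le hxs, sub_zero] at hlip
      exact hlip.trans (by gcongr)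
    calc (stepα a L (0 + 1) * ‖gradient f y‖) ^ 2 * (4 * a)
        ≤ (stepα a L (0 + 1) * (L * R)) ^ 2 * (4 * a) := by
          have := (stepα_succ_pos ha0 hL 0).le
          gcongr
      _ = 4 * R ^ 2 / a := by
          rw [stepα]
          field_simp
          norm_num
      _ ≤ 4 * R ^ 2 := div_le_self (by positivity) ha
      _ ≤ 9 * R ^ 2 := by gcongr; norm_num
  · have hgrad : stepA a L k * ‖gradient f y‖ ^ 2 ≤ L * R ^ 2 := by
      calc stepA a L k * ‖gradient f y‖ ^ 2 ≤ stepA a L k * (2 * L * (f y - f xs)) :=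
            mul_le_mul_of_nonneg_left (norm_gradient_sq_le hL hf.1 hf.2 hxs y)
              (stepA_nonneg ha0.le hL.le k)
        _ = 2 * L * (stepA a L k * (f y - f xs)) := by ring
        _ ≤ 2 * L * (R ^ 2 / 2) := by gcongr
        _ = L * R ^ 2 := by ring
    refine le_of_mul_le_mul_left ?_ hL
    calc L * ((stepα a L (k + 1) * ‖gradient f y‖) ^ 2 * (4 * a))
        = 4 * a * L * stepα a L (k + 1) ^ 2 * ‖gradient f y‖ ^ 2 := by ring
      _ ≤ 9 * stepA a L k * ‖gradient f y‖ ^ 2 :=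
          mul_le_mul_of_nonneg_right (mul_stepα_sq_le_stepA ha0 hL hk) (sq_nonneg _)
      _ ≤ L * (9 * R ^ 2) := by linarith

lemma stepα_mul_norm_gradient_weightedAvg_le (hL : 0 < L) (ha : 1 ≤ a) (hR : 0 ≤ R)
    (hf : LSmooth f L) (hxs : ∀ x, f xs ≤ f x) (hp₁ : ‖p.1 - xs‖ ≤ R)
    (hpot : potential f xs L a k p ≤ R ^ 2 / 2) :
    stepα a L (k + 1) * ‖gradient f (weightedAvg L a k p.1 p.2)‖ ≤
      R * (2 / a + 3 / (2 * √a)) := by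
  have ha0 : 0 < a := by linarith
  have hα := stepα_succ_pos ha0 hL k
  have hA := stepA_succ_pos ha0 hL k
  have hdist : ‖p.2 - p.1‖ ≤ 2 * R := by
    have hp₂ := norm_snd_sub_le_of_potential_le hL.le ha0.le hxs hR hpot
    linarith [norm_sub_le_norm_sub_add_norm_sub p.2 xs p.1, norm_sub_rev xs p.1]
  have hchange : ‖gradient f (weightedAvg L a k p.1 p.2) - gradient f p.1‖ ≤
      L * (stepα a L (k + 1) / stepA a L (k + 1) * (2 * R)) := by
    refine (hf.2 _ _).trans ?_
    rw [weightedAvg_sub_left ha0 hL, norm_smul, Real.norm_of_nonneg (by positivity)]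
    gcongr
  have hfirst : stepα a L (k + 1) * (L * (stepα a L (k + 1) / stepA a L (k + 1) * (2 * R))) ≤
      R * (2 / a) := by
    calc _ = a * L * stepα a L (k + 1) ^ 2 / stepA a L (k + 1) * (R * (2 / a)) := by field_simp
      _ ≤ R * (2 / a) := mul_le_of_le_one_left (by positivity)
          ((div_le_one hA).2 (mul_stepα_sq_le_stepA_succ ha0 hL k))
  have hsecond := stepα_mul_norm_gradient_le hL ha hR hf hxs hp₁
    (stepA_mul_sub_le_of_potential_le hpot)
  calc _ ≤ stepα a L (k + 1) * (L * (stepα a L (k + 1) / stepA a L (k + 1) * (2 * R)) +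
        ‖gradient f p.1‖) := by
        gcongr
        linarith [norm_sub_norm_le (gradient f (weightedAvg L a k p.1 p.2)) (gradient f p.1)]
    _ ≤ R * (2 / a + 3 / (2 * √a)) := by linarith

lemma lintegral_exp_potential_advance_le {Ω : Type*} [MeasurableSpace Ω] {μ : Measure Ω}
    [IsProbabilityMeasure μ] {G : Euc n → Ω → Euc n} {σ s : ℝ} (hL : 0 < L)
    (hconv : ConvexOn ℝ Set.univ f) (hf : LSmooth f L) (hG : IsStochasticGradient f μ G σ)
    (hxs : ∀ x, f xs ≤ f x) (ha : 2 ≤ a) (hB : 0 < B) (hBR : 16 * B ≤ R) (hs : 0 ≤ s)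
    (hsRB : s * R * B ≤ 3 / 8) (haB : R * (2 / a + 3 / (2 * √a)) ≤ B / 2)
    (hp₁ : ‖p.1 - xs‖ ≤ R) (hpot : potential f xs L a k p ≤ R ^ 2 / 2) :
    ∫⁻ ω, ENNReal.ofReal (Real.exp (s * potential f xs L a (k + 1)
        (advance L a B k p (G (weightedAvg L a k p.1 p.2) ω)))) ∂μ ≤
      ENNReal.ofReal (Real.exp (noiseExponent R B s * (stepα a L (k + 1) ^ 2 * σ ^ 2))) *
        ENNReal.ofReal (Real.exp (s * potential f xs L a k p)) := by
  set x := weightedAvg L a k p.1 p.2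
  set α := stepα a L (k + 1)
  have hR : 0 ≤ R := by linarith
  have hα : 0 < α := stepα_succ_pos (by linarith) hL k
  have hp₂ : ‖p.2 - xs‖ ≤ R := norm_snd_sub_le_of_potential_le hL.le (by linarith) hxs hR hpot
  have hgrad : ‖α • gradient f x‖ ≤ B / 2 := by
    rw [norm_smul, Real.norm_of_nonneg hα.le]
    exact (stepα_mul_norm_gradient_weightedAvg_le hL (by linarith) hR hf hxs hp₁ hpot).trans haB
  have hscale (ω : Ω) : ‖α • G x ω - α • gradient f x‖ ^ 2 =
      α ^ 2 * ‖G x ω - gradient f x‖ ^ 2 := by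
    rw [← smul_sub, norm_smul, mul_pow, Real.norm_eq_abs, sq_abs]
  have herror := lintegral_exp_clip_error_le (Y := fun ω => α • G x ω) (v := α ^ 2 * σ ^ 2)
    ((hG.integrable x).smul α) (by rw [integral_smul, hG.unbiased])
    (by simpa only [hscale] using (hG.integrable_sq x).const_mul (α ^ 2))
    (by simpa only [hscale, integral_const_mul] using
      mul_le_mul_of_nonneg_left (hG.variance_le x) (sq_nonneg α))
    hB hgrad hp₂ hBR hs hsRB
  refine le_trans (lintegral_mono fun ω => ?_) ((lintegral_mul_const' _ _
    ENNReal.ofReal_ne_top).trans_le (mul_le_mul_left herror _))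
  rw [← ENNReal.ofReal_mul (Real.exp_pos _).le, ← Real.exp_add]
  refine ENNReal.ofReal_le_ofReal (Real.exp_le_exp.2 ?_)
  refine (mul_le_mul_of_nonneg_left (potential_advance_le hL hconv hf ha p _) hs).trans_eq ?_
  ring

variable {Ξ : Type*} {G : Euc n → Ξ → Euc n} {x₀ : Euc n} {m : ℕ → ℕ}

lemma norm_iterates_fst_sub_le_of_potential_le (hL : 0 < L) (ha : 0 < a) (hR : 0 ≤ R)
    (hxs : ∀ x, f xs ≤ f x) {t : ℕ → ℕ → Ξ}
    (hpot : ∀ i ≤ k, potential f xs L a i (iterates G x₀ L a B m t i) ≤ R ^ 2 / 2) :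
    ‖(iterates G x₀ L a B m t k).1 - xs‖ ≤ R :=
  mem_closedBall_iff_norm.1 <| iterates_fst_mem (convex_closedBall xs R) ha hL fun i hi =>
    mem_closedBall_iff_norm.2 <|
      norm_snd_sub_le_of_potential_le hL.le ha.le hxs hR (hpot i hi)

end Potential

/-! ### A maximal inequality -/

section MaximalInequality

variable {Ω : Type*} [MeasurableSpace Ω] {μ : Measure Ω}

lemma mul_measure_inter_add_setLIntegral_le {W : Ω → ENNReal} (hW : Measurable W) (c : ENNReal)
    (A : Set Ω) :
    c * μ (A ∩ {ω | c < W ω}) + ∫⁻ ω in A ∩ {ω | W ω ≤ c}, W ω ∂μ ≤ ∫⁻ ω in A, W ω ∂μ := by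
  have hmeas : MeasurableSet {ω | W ω ≤ c} := measurableSet_le hW measurable_const
  have hcompl : A \ {ω | W ω ≤ c} = A ∩ {ω | c < W ω} := by
    ext ω
    simp only [Set.mem_sdiff, Set.mem_inter_iff, Set.mem_ofPred_eq, not_le]
  rw [← lintegral_inter_add_sdiff W A hmeas, add_comm, hcompl]
  gcongr
  rw [← setLIntegral_const]
  exact setLIntegral_mono hW fun ω hω => hω.2.le

lemma mul_measure_exists_lt_le {W : ℕ → Ω → ENNReal} (hW : ∀ k, Measurable (W k))
    {c ρ : ENNReal} (hρ : 1 ≤ ρ) {N : ℕ}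
    (hdrift : ∀ k < N, ∫⁻ ω in {ω | ∀ i ≤ k, W i ω ≤ c}, W (k + 1) ω ∂μ ≤
      ρ * ∫⁻ ω in {ω | ∀ i ≤ k, W i ω ≤ c}, W k ω ∂μ) :
    c * μ {ω | ∃ i ≤ N, c < W i ω} ≤ ρ ^ N * ∫⁻ ω, W 0 ω ∂μ := by
  suffices hstopped : c * μ {ω | ∃ i ≤ N, c < W i ω} +
      ∫⁻ ω in {ω | ∀ i ≤ N, W i ω ≤ c}, W N ω ∂μ ≤ ρ ^ N * ∫⁻ ω, W 0 ω ∂μ from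
    le_self_add.trans hstopped
  induction N with
  | zero =>
    simpa only [Nat.le_zero, exists_eq_left, forall_eq, pow_zero, one_mul, Set.univ_inter,
      Measure.restrict_univ] using mul_measure_inter_add_setLIntegral_le (hW 0) c Set.univ
  | succ N ih =>
    set A := {ω | ∀ i ≤ N, W i ω ≤ c}
    have hstay : {ω | ∀ i ≤ N + 1, W i ω ≤ c} = A ∩ {ω | W (N + 1) ω ≤ c} := by
      ext ω
      exact ⟨fun h => ⟨fun i hi => h i (hi.trans N.le_succ), h _ le_rfl⟩,
        fun h i hi => (Nat.le_succ_iff.1 hi).elim (h.1 i) fun hiN => hiN ▸ h.2⟩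
    have hleave : {ω | ∃ i ≤ N + 1, c < W i ω} ⊆
        {ω | ∃ i ≤ N, c < W i ω} ∪ A ∩ {ω | c < W (N + 1) ω} := by
      rintro ω ⟨i, hi, hlt⟩
      by_cases hA : ω ∈ A
      · refine .inr ⟨hA, ?_⟩
        rcases Nat.le_succ_iff.1 hi with hiN | rfl
        · exact absurd hlt (hA i hiN).not_gt
        · exact hlt
      · refine .inl ?_
        simpa only [A, Set.mem_ofPred_eq, not_forall, not_le, exists_prop] using hA
    calc c * μ {ω | ∃ i ≤ N + 1, c < W i ω} + ∫⁻ ω in {ω | ∀ i ≤ N + 1, W i ω ≤ c}, W (N + 1) ω ∂μ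
        ≤ c * (μ {ω | ∃ i ≤ N, c < W i ω} + μ (A ∩ {ω | c < W (N + 1) ω})) +
            ∫⁻ ω in A ∩ {ω | W (N + 1) ω ≤ c}, W (N + 1) ω ∂μ := by
          rw [hstay]
          gcongr
          exact (measure_mono hleave).trans (measure_union_le _ _)
      _ ≤ c * μ {ω | ∃ i ≤ N, c < W i ω} + ∫⁻ ω in A, W (N + 1) ω ∂μ := by
          rw [mul_add, add_assoc]
          gcongr
          exact mul_measure_inter_add_setLIntegral_le (hW _) c A
      _ ≤ ρ * (c * μ {ω | ∃ i ≤ N, c < W i ω}) + ρ * ∫⁻ ω in A, W N ω ∂μ := by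
          exact add_le_add (le_mul_of_one_le_left zero_le hρ) (hdrift N N.lt_succ_self)
      _ ≤ ρ ^ (N + 1) * ∫⁻ ω, W 0 ω ∂μ := by
          rw [← mul_add, pow_succ', mul_assoc]
          gcongr
          exact ih fun k hk => hdrift k (hk.trans N.lt_succ_self)

lemma setLIntegral_comp_of_indepFun [IsProbabilityMeasure μ] {α β : Type*} [MeasurableSpace α]
    [MeasurableSpace β] {X : Ω → α} {Y : Ω → β} {A : Set Ω} (hX : Measurable X)
    (hY : Measurable Y) (hA : MeasurableSet A)
    (hind : IndepFun (fun ω => (X ω, ω ∈ A)) Y μ) {h : α × β → ENNReal} (hh : Measurable h) :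
    ∫⁻ ω in A, h (X ω, Y ω) ∂μ = ∫⁻ ω in A, ∫⁻ ω', h (X ω, Y ω') ∂μ ∂μ := by
  classical
  have : IsProbabilityMeasure (μ.map Y) := Measure.isProbabilityMeasure_map hY.aemeasurable
  have hXA : Measurable fun ω => (X ω, ω ∈ A) := hX.prodMk hA.mem
  let g : (α × Prop) × β → ENNReal := fun q => if q.1.2 then h (q.1.1, q.2) else 0
  have hg : Measurable g :=
    Measurable.ite (measurableSet_setOfPred.2 measurable_fst.snd)
      (hh.comp (measurable_fst.fst.prodMk measurable_snd)) measurable_const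
  have key : ∫⁻ ω, g ((X ω, ω ∈ A), Y ω) ∂μ = ∫⁻ ω, ∫⁻ ω', g ((X ω, ω ∈ A), Y ω') ∂μ ∂μ := by
    rw [← lintegral_map (f := g) (g := fun ω => ((X ω, ω ∈ A), Y ω)) hg (hXA.prodMk hY),
      hind.map_prod_eq_prod_map_map hXA.aemeasurable hY.aemeasurable,
      lintegral_prod _ hg.aemeasurable, lintegral_map hg.lintegral_prod_right' hXA]
    exact lintegral_congr fun ω => lintegral_map (hg.comp measurable_prodMk_left) hY
  rw [← lintegral_indicator hA, ← lintegral_indicator hA]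
  refine (lintegral_congr fun ω => ?_).trans (key.trans (lintegral_congr fun ω => ?_)) <;>
    by_cases hω : ω ∈ A <;> simp [g, hω]

end MaximalInequality

/-! ### High-probability control of the potential -/

section Samples

variable {Ξ Ω : Type*} [MeasurableSpace Ξ] [MeasurableSpace Ω] {μ : Measure Ω} {P : Measure Ξ}
  {ξ : ℕ × ℕ → Ω → Ξ}

lemma IsIIDSample.measurePreserving (hξ : IsIIDSample μ P ξ) (p : ℕ × ℕ) :
    MeasurePreserving (ξ p) μ P :=
  ⟨hξ.measurable p, hξ.map_eq p⟩

lemma IsIIDSample.indepFun_block (hξ : IsIIDSample μ P ξ) (k : ℕ) {α : Type*} [MeasurableSpace α]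
    {X : Ω → α}
    (hX : Measurable[⨆ p ∈ {p : ℕ × ℕ | p.1 < k}, MeasurableSpace.comap (ξ p) inferInstance] X) :
    IndepFun X (fun ω i => ξ (k, i) ω) μ := by
  have hdisj : Disjoint {p : ℕ × ℕ | p.1 < k} {p : ℕ × ℕ | p.1 = k} :=
    Set.disjoint_left.2 fun p hlt heq => (heq ▸ hlt : k < k).ne rfl
  rw [IndepFun_iff_Indep]
  refine indep_of_indep_of_le_left (indep_of_indep_of_le_right
    (indep_iSup_of_disjoint (fun p => (hξ.measurable p).comap_le) hξ.indep hdisj) ?_) hX.comap_le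
  refine Measurable.comap_le (@measurable_pi_lambda _ _ _ (_) _ _ fun i => ?_)
  exact measurable_iff_comap_le.2 (le_iSup₂_of_le (k, i) rfl le_rfl)

end Samples

section Trajectory

variable {n : ℕ} {Ξ Ω : Type*} [MeasurableSpace Ξ] {mΩ : MeasurableSpace Ω} {μ : Measure Ω}
  {P : Measure Ξ} {f : Euc n → ℝ} {G : Euc n → Ξ → Euc n} {ξ : ℕ × ℕ → Ω → Ξ} {x₀ xs : Euc n}
  {L σ a B R s v : ℝ} {m : ℕ → ℕ} {k : ℕ}

lemma measurable_potential_iterates (hf : Continuous f) (hG : Measurable (Function.uncurry G))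
    (hξ : ∀ p : ℕ × ℕ, p.1 < k → Measurable (ξ p)) :
    Measurable fun ω => potential f xs L a k (iterates G x₀ L a B m (fun j i => ξ (j, i) ω) k) := by
  simpa only [Function.comp_def] using
    (measurable_potential hf xs L a k).comp (measurable_iterates hG hξ)

lemma measurable_forall_potential_iterates_le (hf : Continuous f)
    (hG : Measurable (Function.uncurry G)) (hξ : ∀ p : ℕ × ℕ, p.1 < k → Measurable (ξ p)) (c : ℝ) :
    Measurable fun ω => ∀ i ≤ k,
      potential f xs L a i (iterates G x₀ L a B m (fun j i => ξ (j, i) ω) i) ≤ c := by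
  refine measurableSet_setOfPred.1 ?_
  simp only [Set.ofPred_forall]
  exact MeasurableSet.iInter fun i => MeasurableSet.iInter fun hi =>
    measurableSet_le (measurable_potential_iterates hf hG fun p hp => hξ p (hp.trans_le hi))
      measurable_const

lemma IsIIDSample.indepFun_iterates (hξ : IsIIDSample μ P ξ) (hf : Continuous f)
    (hG : Measurable (Function.uncurry G)) (xs x₀ : Euc n) (L a B : ℝ) (m : ℕ → ℕ) (k : ℕ)
    (c : ℝ) :
    IndepFun (fun ω => (iterates G x₀ L a B m (fun j i => ξ (j, i) ω) k,
      ∀ i ≤ k, potential f xs L a i (iterates G x₀ L a B m (fun j i => ξ (j, i) ω) i) ≤ c))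
      (fun ω i => ξ (k, i) ω) μ := by
  have hpast (p : ℕ × ℕ) (hp : p.1 < k) : Measurable[⨆ p ∈ {p : ℕ × ℕ | p.1 < k},
      MeasurableSpace.comap (ξ p) inferInstance] (ξ p) :=
    measurable_iff_comap_le.2 (le_iSup₂_of_le p hp le_rfl)
  exact hξ.indepFun_block k ((measurable_iterates hG hpast).prodMk
    (measurable_forall_potential_iterates_le hf hG hpast c))

lemma setLIntegral_exp_potential_iterates_succ_le [IsProbabilityMeasure μ] (hL : 0 < L)
    (hconv : ConvexOn ℝ Set.univ f) (hf : LSmooth f L) (hG : IsStochasticGradient f P G σ)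
    (hξ : IsIIDSample μ P ξ) (hxs : ∀ x, f xs ≤ f x) (ha : 2 ≤ a) (hB : 0 < B)
    (hBR : 16 * B ≤ R) (hs : 0 ≤ s) (hsRB : s * R * B ≤ 3 / 8)
    (haB : R * (2 / a + 3 / (2 * √a)) ≤ B / 2) (hm : m k ≠ 0)
    (hv : stepα a L (k + 1) ^ 2 * (σ / √(m k)) ^ 2 ≤ v) :
    let V (i : ℕ) (ω : Ω) : ℝ :=
      potential f xs L a i (iterates G x₀ L a B m (fun j i => ξ (j, i) ω) i)
    ∫⁻ ω in {ω | ∀ i ≤ k, V i ω ≤ R ^ 2 / 2}, ENNReal.ofReal (Real.exp (s * V (k + 1) ω)) ∂μ ≤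
      ENNReal.ofReal (Real.exp (noiseExponent R B s * v)) *
        ∫⁻ ω in {ω | ∀ i ≤ k, V i ω ≤ R ^ 2 / 2}, ENNReal.ofReal (Real.exp (s * V k ω)) ∂μ := by
  intro V
  have hR : 0 ≤ R := by linarith
  have ha0 : 0 < a := by linarith
  have hfc : Continuous f := hf.1.continuous
  set A : Set Ω := {ω | ∀ i ≤ k, V i ω ≤ R ^ 2 / 2}
  have hA : MeasurableSet A := measurableSet_setOfPred.2
    (measurable_forall_potential_iterates_le hfc hG.measurable (fun p _ => hξ.measurable p) _)
  have hnext : Measurable fun q : (Euc n × Euc n) × (ℕ → Ξ) =>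
      ENNReal.ofReal (Real.exp (s * potential f xs L a (k + 1) (advance L a B k q.1
        (miniBatch G (weightedAvg L a k q.1.1 q.1.2) (m k) q.2)))) := by
    have hpot := (measurable_potential hfc xs L a (k + 1)).comp
      (measurable_advance_miniBatch hG.measurable L a B k (m k))
    simp only [Function.comp_def] at hpot
    exact (hpot.const_mul s).exp.ennreal_ofReal
  have hgrad := hG.miniBatch (fun i => hξ.measurePreserving (k, i))
    (fun i j hij => hξ.indep.indepFun (by simpa using hij)) hm
  rw [← lintegral_const_mul' _ _ ENNReal.ofReal_ne_top]
  calc _ = ∫⁻ ω in A, ∫⁻ ω', ENNReal.ofReal (Real.exp (s * potential f xs L a (k + 1)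
        (advance L a B k (iterates G x₀ L a B m (fun j i => ξ (j, i) ω) k)
          (miniBatch G (weightedAvg L a k _ _) (m k) fun i => ξ (k, i) ω')))) ∂μ ∂μ :=
        setLIntegral_comp_of_indepFun (measurable_iterates hG.measurable fun p _ => hξ.measurable p)
          (measurable_pi_lambda _ fun i => hξ.measurable (k, i)) hA
          (hξ.indepFun_iterates hfc hG.measurable xs x₀ L a B m k _) hnext
    _ ≤ _ := setLIntegral_mono' hA fun ω hω => by
        refine (lintegral_exp_potential_advance_le hL hconv hf hgrad hxs ha hB hBR hs hsRB haB
          (norm_iterates_fst_sub_le_of_potential_le hL ha0 hR hxs hω) (hω k le_rfl)).trans ?_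
        have := noiseExponent_nonneg hR hB.le hs
        gcongr

lemma measure_exists_lt_potential_iterates_le [IsProbabilityMeasure μ] (hL : 0 < L)
    (hconv : ConvexOn ℝ Set.univ f) (hf : LSmooth f L) (hG : IsStochasticGradient f P G σ)
    (hξ : IsIIDSample μ P ξ) (hxs : ∀ x, f xs ≤ f x) (ha : 2 ≤ a) (hB : 0 < B)
    (hBR : 16 * B ≤ R) (hs : 0 < s) (hsRB : s * R * B ≤ 3 / 8)
    (haB : R * (2 / a + 3 / (2 * √a)) ≤ B / 2) (hm : ∀ k, m k ≠ 0) (hv0 : 0 ≤ v) {N : ℕ}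
    (hv : ∀ k < N, stepα a L (k + 1) ^ 2 * (σ / √(m k)) ^ 2 ≤ v) :
    μ {ω | ∃ i ≤ N, R ^ 2 / 2 <
        potential f xs L a i (iterates G x₀ L a B m (fun j i => ξ (j, i) ω) i)} ≤
      ENNReal.ofReal (Real.exp (N * (noiseExponent R B s * v) + s * (‖x₀ - xs‖ ^ 2 / 2) -
        s * (R ^ 2 / 2))) := by
  have hle (x y : ℝ) : ENNReal.ofReal (Real.exp (s * x)) ≤ ENNReal.ofReal (Real.exp (s * y)) ↔
      x ≤ y := by
    rw [ENNReal.ofReal_le_ofReal_iff (Real.exp_pos _).le, Real.exp_le_exp, mul_le_mul_iff_right₀ hs]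
  have hlt (x y : ℝ) : ENNReal.ofReal (Real.exp (s * x)) < ENNReal.ofReal (Real.exp (s * y)) ↔
      x < y := by
    rw [← not_le, hle, not_le]
  have hstart (ω : Ω) : potential f xs L a 0 (iterates G x₀ L a B m (fun j i => ξ (j, i) ω) 0) =
      ‖x₀ - xs‖ ^ 2 / 2 := by
    simp only [potential, stepA, iterates, zero_mul, zero_add]
  have hdrift : 1 ≤ ENNReal.ofReal (Real.exp (noiseExponent R B s * v)) := by
    rw [ENNReal.one_le_ofReal]
    exact Real.one_le_exp (mul_nonneg (noiseExponent_nonneg (by linarith) hB.le hs.le) hv0)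
  have hmax := mul_measure_exists_lt_le (μ := μ) (N := N)
    (c := ENNReal.ofReal (Real.exp (s * (R ^ 2 / 2))))
    (W := fun i ω => ENNReal.ofReal (Real.exp (s * potential f xs L a i
      (iterates G x₀ L a B m (fun j i => ξ (j, i) ω) i))))
    (fun i => ((measurable_potential_iterates hf.1.continuous hG.measurable
      fun p _ => hξ.measurable p).const_mul s).exp.ennreal_ofReal) hdrift
    (fun k hk => by
      simpa only [hle] using setLIntegral_exp_potential_iterates_succ_le hL hconv hf hG hξ hxs ha
        hB hBR hs.le hsRB haB (hm k) (hv k hk))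
  simp only [hlt, hstart, lintegral_const, measure_univ, mul_one] at hmax
  rw [← ENNReal.ofReal_pow (Real.exp_pos _).le, ← Real.exp_nat_mul,
    ← ENNReal.ofReal_mul (Real.exp_pos _).le, ← Real.exp_add, mul_comm,
    ← ENNReal.le_div_iff_mul_le (.inl (ENNReal.ofReal_pos.2 (Real.exp_pos _)).ne')
      (.inl ENNReal.ofReal_ne_top)] at hmax
  rwa [Real.exp_sub, ENNReal.ofReal_div_of_pos (Real.exp_pos _)]

end Trajectory

/-! ### Convergence rate -/

section Rate

variable {N : ℕ} {β a L σ R₀ : ℝ}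

lemma Admissible.logN_mul_sqrt_le (h : Admissible N β a) :
    24 * logN N β * √a + 72 * logN N β ≤ a := by
  obtain ⟨-, hl, hmin⟩ := h
  set l := logN N β
  set r := √(4 * l ^ 2 + 2 * l)
  have hbound : 36 * (2 * l + r) ^ 2 ≤ a :=
    ((le_max_right _ _).trans (le_max_right _ _)).trans hmin
  have : 0 ≤ r := Real.sqrt_nonneg _
  have hr : r ^ 2 = 4 * l ^ 2 + 2 * l := Real.sq_sqrt (by positivity)
  have hsqrt : 6 * (2 * l + r) ≤ √a := Real.le_sqrt_of_sq_le (by linarith)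
  have hsq : √a ^ 2 = a := Real.sq_sqrt (le_trans (by positivity) hbound)
  have hdiff : (6 * r) ^ 2 ≤ (√a - 12 * l) ^ 2 :=
    pow_le_pow_left₀ (by positivity) (by linarith) 2
  linarith

lemma Admissible.two_le (h : Admissible N β a) : 2 ≤ a := by
  have hl := h.2.1
  have hsqrt : 0 ≤ 24 * logN N β * √a := by positivity
  linarith [h.logN_mul_sqrt_le]

lemma exp_neg_logN (hN : 1 ≤ N) (hβ : 0 < β) : Real.exp (-logN N β) = β / (4 * N) := by
  have : (0 : ℝ) < N := Nat.cast_pos.2 hN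
  rw [logN, Real.exp_neg, Real.exp_log (by positivity), inv_div]

lemma mul_clipB_le (hl : 2 ≤ logN N β) (hR₀ : 0 ≤ R₀) : 16 * clipB N β R₀ ≤ √5 * R₀ := by
  have hR : 0 ≤ √5 * R₀ := by positivity
  rw [clipB, ← mul_div_assoc, div_le_iff₀ (by positivity)]
  linarith [mul_le_mul_of_nonneg_left hl hR]

lemma Admissible.le_clipB (h : Admissible N β a) (hR₀ : 0 ≤ R₀) :
    √5 * R₀ * (2 / a + 3 / (2 * √a)) ≤ clipB N β R₀ / 2 := by
  have ha : 0 < a := by linarith [h.two_le]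
  have hl : 0 < logN N β := by linarith [h.2.1]
  have hlhs : 2 / a + 3 / (2 * √a) = (2 + 3 / 2 * √a) / a := by
    field_simp
    linear_combination (-3) * Real.sq_sqrt ha.le
  have hrhs : clipB N β R₀ / 2 = √5 * R₀ * (1 / (16 * logN N β)) := by
    rw [clipB]
    field_simp
    ring
  rw [hrhs, hlhs]
  gcongr ?_ * ?_
  rw [div_le_div_iff₀ ha (by positivity)]
  linarith [h.logN_mul_sqrt_le]

lemma batchSize_ne_zero (L σ R₀ a : ℝ) (N : ℕ) (β : ℝ) (k : ℕ) : batchSize L σ R₀ a N β k ≠ 0 :=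
  (Nat.ceil_pos.2 (zero_lt_one.trans_le (le_max_left _ _))).ne'

lemma stepα_sq_mul_variance_le (hN : 1 ≤ N) (hl : 0 < logN N β) (hR₀ : 0 < R₀)
    (L σ a : ℝ) (k : ℕ) :
    stepα a L (k + 1) ^ 2 * (σ / √(batchSize L σ R₀ a N β k)) ^ 2 ≤
      (√5 * R₀) ^ 2 / (6000 * N * logN N β) := by
  have : (0 : ℝ) < N := Nat.cast_pos.2 hN
  have hm : (0 : ℝ) < batchSize L σ R₀ a N β k :=
    Nat.cast_pos.2 (batchSize_ne_zero L σ R₀ a N β k).bot_lt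
  have hbatch : 6000 * σ ^ 2 * stepα a L (k + 1) ^ 2 * N * logN N β / (√5 * R₀) ^ 2 ≤
      batchSize L σ R₀ a N β k := by
    rw [mul_pow]
    exact ((le_max_left _ _).trans (le_max_right _ _)).trans (Nat.le_ceil _)
  rw [div_le_iff₀ (by positivity)] at hbatch
  rw [div_pow, Real.sq_sqrt hm.le, ← mul_div_assoc, div_le_div_iff₀ hm (by positivity)]
  linarith

lemma exponent_le_neg_logN (hN : 1 ≤ N) (hl : 2 ≤ logN N β) (hR₀ : 0 < R₀) :
    N * (noiseExponent (√5 * R₀) (clipB N β R₀) (3 * logN N β / (√5 * R₀) ^ 2) *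
        ((√5 * R₀) ^ 2 / (6000 * N * logN N β))) +
      3 * logN N β / (√5 * R₀) ^ 2 * (R₀ ^ 2 / 2) -
      3 * logN N β / (√5 * R₀) ^ 2 * ((√5 * R₀) ^ 2 / 2) ≤ -logN N β := by
  have hN0 : (N : ℝ) ≠ 0 := Nat.cast_ne_zero.2 (by omega)
  have hl0 : logN N β ≠ 0 := by linarith
  have hnoise : N * (noiseExponent (√5 * R₀) (clipB N β R₀) (3 * logN N β / (√5 * R₀) ^ 2) *
      ((√5 * R₀) ^ 2 / (6000 * N * logN N β))) = (30 * logN N β + 3) / 6000 := by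
    rw [noiseExponent, clipB]
    field_simp
    ring
  have hstart : 3 * logN N β / (√5 * R₀) ^ 2 * (R₀ ^ 2 / 2) = 3 * logN N β / 10 := by
    rw [mul_pow, Real.sq_sqrt (by norm_num)]
    field_simp
    ring
  have hlevel : 3 * logN N β / (√5 * R₀) ^ 2 * ((√5 * R₀) ^ 2 / 2) = 3 * logN N β / 2 := by
    field_simp
  rw [hnoise, hstart, hlevel]
  linarith

variable {n : ℕ} {Ξ Ω : Type*} [MeasurableSpace Ξ] [MeasurableSpace Ω] {P : Measure Ξ}
  {μ : Measure Ω} {f : Euc n → ℝ} {G : Euc n → Ξ → Euc n} {ξ : ℕ × ℕ → Ω → Ξ} {x₀ xs : Euc n}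

lemma Admissible.measure_exists_lt_potential_le [IsProbabilityMeasure μ] (h : Admissible N β a)
    (hL : 0 < L) (hβ : 0 < β) (hconv : ConvexOn ℝ Set.univ f) (hf : LSmooth f L)
    (hG : IsStochasticGradient f P G σ) (hξ : IsIIDSample μ P ξ) (hxs : ∀ x, f xs ≤ f x)
    (hR₀ : R₀ = ‖x₀ - xs‖) (hR₀pos : 0 < R₀) :
    μ {ω | ∃ i ≤ N, (√5 * R₀) ^ 2 / 2 < potential f xs L a i (iterates G x₀ L a (clipB N β R₀)
      (batchSize L σ R₀ a N β) (fun j i => ξ (j, i) ω) i)} ≤ ENNReal.ofReal β := by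
  have hl : 0 < logN N β := by linarith [h.2.1]
  have hB : 0 < clipB N β R₀ := by
    rw [clipB]
    positivity
  have hsRB : 3 * logN N β / (√5 * R₀) ^ 2 * (√5 * R₀) * clipB N β R₀ ≤ 3 / 8 := by
    rw [clipB]
    exact le_of_eq (by field_simp)
  refine (measure_exists_lt_potential_iterates_le (s := 3 * logN N β / (√5 * R₀) ^ 2)
    hL hconv hf hG hξ hxs h.two_le hB (mul_clipB_le h.2.1 hR₀pos.le) (by positivity) hsRB
    (h.le_clipB hR₀pos.le) (batchSize_ne_zero L σ R₀ a N β) (by positivity)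
    fun k _ => stepα_sq_mul_variance_le h.1 hl hR₀pos L σ a k).trans ?_
  rw [← hR₀]
  refine ENNReal.ofReal_le_ofReal ((Real.exp_le_exp.2
    (exponent_le_neg_logN h.1 h.2.1 hR₀pos)).trans ?_)
  have hN : (1 : ℝ) ≤ N := Nat.one_le_cast.2 h.1
  rw [exp_neg_logN h.1 hβ]
  exact div_le_self hβ.le (by linarith)

lemma sub_le_of_potential_le {p : Euc n × Euc n} (hN : 1 ≤ N) (ha : 0 < a) (hL : 0 < L)
    (hp : potential f xs L a N p ≤ (√5 * R₀) ^ 2 / 2) :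
    f p.1 - f xs ≤ 10 * a * L * R₀ ^ 2 / (N * (N + 3)) := by
  have : (0 : ℝ) < N := Nat.cast_pos.2 hN
  have hgap := stepA_mul_sub_le_of_potential_le hp
  rw [stepA_eq, mul_pow, Real.sq_sqrt (by norm_num), mul_comm, ← le_div_iff₀ (by positivity)]
    at hgap
  refine hgap.trans_eq ?_
  field_simp
  ring

theorem Admissible.one_sub_le_measure_output_sub_le [IsProbabilityMeasure μ]
    (h : Admissible N β a) (hL : 0 < L) (hβ : 0 < β) (hconv : ConvexOn ℝ Set.univ f)
    (hf : LSmooth f L) (hG : IsStochasticGradient f P G σ) (hξ : IsIIDSample μ P ξ)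
    (hxs : ∀ x, f xs ≤ f x) (hR₀ : R₀ = ‖x₀ - xs‖) (hR₀pos : 0 < R₀) :
    1 - β ≤ μ.real {ω | f (output G ξ x₀ L σ R₀ a N β ω) - f xs ≤
      10 * a * L * R₀ ^ 2 / (N * (N + 3))} := by
  set exit : Set Ω := {ω | ∃ i ≤ N, (√5 * R₀) ^ 2 / 2 < potential f xs L a i (iterates G x₀ L a
    (clipB N β R₀) (batchSize L σ R₀ a N β) (fun j i => ξ (j, i) ω) i)}
  have hexit : μ.real exit ≤ β := ENNReal.toReal_le_of_le_ofReal hβ.le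
    (h.measure_exists_lt_potential_le hL hβ hconv hf hG hξ hxs hR₀ hR₀pos)
  have hcover : 1 ≤ μ.real exit + μ.real exitᶜ := by
    rw [← probReal_univ (μ := μ), ← Set.union_compl_self exit]
    exact measureReal_union_le _ _
  refine (by linarith : 1 - β ≤ μ.real exitᶜ).trans (measureReal_mono fun ω hω => ?_)
  refine sub_le_of_potential_le h.1 (by linarith [h.two_le]) hL (not_lt.1 fun hlt => hω ?_)
  exact ⟨N, le_rfl, hlt⟩

end Rate

/-! ### Choice of the number of iterations -/

section Logarithms

variable {u w β N : ℝ}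

lemma log_le_log_add_div_sub_one {y s : ℝ} (hy : 0 < y) (hs : 0 < s) :
    Real.log y ≤ Real.log s + y / s - 1 := by
  have h := Real.log_le_sub_one_of_pos (div_pos hy hs)
  rw [Real.log_div hy.ne' hs.ne'] at h
  linarith

lemma log_two_le_log_div (hu : 2 ≤ u) (hβ : 0 < β) (hβ1 : β < 1) :
    Real.log 2 ≤ Real.log (u / β) :=
  Real.log_le_log two_pos (hu.trans (le_div_self (by linarith) hβ hβ1.le))

lemma half_lt_log_div (hu : 2 ≤ u) (hβ : 0 < β) (hβ1 : β < 1) : 1 / 2 < Real.log (u / β) := by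
  linarith [log_two_le_log_div hu hβ hβ1, Real.log_two_gt_d9]

lemma log_mul_log_div_le (hw : 0 < w) (hwu : w ≤ u ^ 2) (hu : 2 ≤ u) (hβ : 0 < β) (hβ1 : β < 1) :
    Real.log (4 * (65536 * (w * Real.log (u / β))) / β) ≤ 21 * Real.log (u / β) := by
  have hlog2 := log_two_le_log_div hu hβ hβ1
  have hpos := half_lt_log_div hu hβ hβ1
  have hsplit : Real.log (u / β) = Real.log u - Real.log β :=
    Real.log_div (by linarith) hβ.ne'
  have hlogβ : Real.log β < 0 := Real.log_neg hβ hβ1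
  have hlogw : Real.log w ≤ 2 * Real.log u := by
    simpa only [Real.log_pow, Nat.cast_ofNat] using Real.log_le_log hw hwu
  have hloglog : Real.log (Real.log (u / β)) ≤ Real.log (u / β) - 1 :=
    Real.log_le_sub_one_of_pos (by linarith)
  set lam := Real.log (u / β)
  have hprod : Real.log (4 * (65536 * (w * lam)) / β) =
      18 * Real.log 2 + Real.log w + Real.log lam - Real.log β := by
    rw [show 4 * (65536 * (w * lam)) = 2 ^ 18 * w * lam by ring,
      Real.log_div (by positivity) hβ.ne', Real.log_mul (by positivity) (by linarith),
      Real.log_mul (by norm_num) hw.ne', Real.log_pow, Nat.cast_ofNat]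
  rw [hprod]
  linarith

lemma mul_log_le_of_mul_log_div_le (hw : 0 < w) (hwu : w ≤ u ^ 2) (hu : 2 ≤ u) (hβ : 0 < β)
    (hβ1 : β < 1) (hN : 65536 * (w * Real.log (u / β)) ≤ N) :
    700 * w * Real.log (4 * N / β) ≤ N := by
  have hbound := log_mul_log_div_le hw hwu hu hβ hβ1
  have hlam := half_lt_log_div hu hβ hβ1
  set lam := Real.log (u / β)
  have hs : 0 < 65536 * (w * lam) := by positivity
  have hN0 : 0 < N := hs.trans_le hN
  -- Bounding `log` by its tangent makes the condition on `N` linear.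
  have htangent : Real.log (4 * N / β) ≤ 21 * lam + N / (65536 * (w * lam)) - 1 := by
    have h := log_le_log_add_div_sub_one (y := 4 * N / β) (s := 4 * (65536 * (w * lam)) / β)
      (by positivity) (by positivity)
    rw [div_div_div_cancel_right₀ hβ.ne', mul_div_mul_left _ _ four_ne_zero] at h
    linarith
  have hratio : 700 * w * (N / (65536 * (w * lam))) ≤ N / 2 := by
    rw [← mul_div_assoc, div_le_div_iff₀ hs two_pos]
    nlinarith [mul_pos hw hN0]
  calc 700 * w * Real.log (4 * N / β)
      ≤ 700 * w * (21 * lam + N / (65536 * (w * lam)) - 1) := by gcongr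
    _ ≤ N := by linarith

lemma sq_le_of_two_mul_log_lt (hN : 0 < N) (hu : 0 < u) (hβ : 0 < β) (hβ1 : β < 1)
    (h : 2 * Real.log (4 * N / β) < Real.log (u / β)) : N ^ 2 ≤ u := by
  have hlt : (4 * N / β) ^ 2 < u / β := by
    rw [← Real.log_lt_log_iff (by positivity) (by positivity), Real.log_pow]
    exact_mod_cast h
  rw [div_pow, div_lt_div_iff₀ (by positivity) hβ, pow_two β, ← mul_assoc,
    mul_lt_mul_iff_left₀ hβ] at hlt
  linarith [sq_nonneg N, mul_le_of_le_one_right hu.le hβ1.le]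

lemma sq_div_log_le {K : ℝ} (hK : 1 ≤ K) (hN : 1 ≤ N) (hβ : 0 < β) (hβ1 : β < 1)
    (hl : 2 ≤ Real.log (4 * N / β)) (hu : 0 < u) (hNu : N ≤ 2 * K * (u * Real.log (u / β))) :
    N ^ 2 / Real.log (4 * N / β) ≤ 8 * K ^ 2 * (u ^ 2 * Real.log (u / β)) := by
  have hlarge := sq_le_of_two_mul_log_lt (zero_lt_one.trans_le hN) hu hβ hβ1
  set l := Real.log (4 * N / β)
  set lam := Real.log (u / β)
  have hlam : 0 < lam := by
    rw [← mul_assoc] at hNu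
    exact (mul_pos_iff_of_pos_left (by positivity)).1 (zero_lt_one.trans_le (hN.trans hNu))
  rw [div_le_iff₀ (by linarith)]
  rcases le_or_gt lam (2 * l) with h | h
  · calc N ^ 2 ≤ (2 * K * (u * lam)) ^ 2 := by gcongr
      _ = 4 * K ^ 2 * (u ^ 2 * lam) * lam := by ring
      _ ≤ 4 * K ^ 2 * (u ^ 2 * lam) * (2 * l) := by gcongr
      _ = 8 * K ^ 2 * (u ^ 2 * lam) * l := by ring
  · have hNu' : N ^ 2 ≤ u := hlarge h
    have hu1 : 1 ≤ u := (one_le_pow₀ hN).trans hNu'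
    have hlogs : 1 ≤ 8 * K ^ 2 * (lam * l) :=
      one_le_mul_of_one_le_of_one_le (by linarith [one_le_pow₀ (n := 2) hK])
        (one_le_mul_of_one_le_of_one_le (by linarith) (by linarith))
    calc N ^ 2 ≤ u ^ 2 := hNu'.trans (le_self_pow₀ hu1 two_ne_zero)
      _ ≤ u ^ 2 * (8 * K ^ 2 * (lam * l)) := le_mul_of_one_le_right (by positivity) hlogs
      _ = 8 * K ^ 2 * (u ^ 2 * lam) * l := by ring

end Logarithms

section Admissibility

variable {N : ℕ} {u w a₀ v β a L R₀ ε : ℝ}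

lemma aMin_le (hl : 2 ≤ logN N β) : aMin N β ≤ 648 * logN N β ^ 2 := by
  rw [aMin]
  set l := logN N β
  refine max_le (by nlinarith) (max_le ?_ ?_)
  · have hsqrt : (1 : ℝ) ≤ √5 := Real.one_le_sqrt.2 (by norm_num)
    refine (div_le_self (by linarith) hsqrt).trans ?_
    nlinarith
  · have hsqrt : √(4 * l ^ 2 + 2 * l) ≤ 2.24 * l :=
      Real.sqrt_le_iff.2 ⟨by linarith, by nlinarith⟩
    calc 36 * (2 * l + √(4 * l ^ 2 + 2 * l)) ^ 2
        ≤ 36 * (2 * l + 2.24 * l) ^ 2 := by gcongr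
      _ ≤ 648 * l ^ 2 := by nlinarith

lemma Admissible.sq_le (h : Admissible N β a) : 576 * logN N β ^ 2 ≤ a := by
  have hl := h.2.1
  have ha : 0 < a := by linarith [h.two_le]
  have hsqrt : 24 * logN N β ≤ √a := by
    refine le_of_mul_le_mul_right ?_ (Real.sqrt_pos.2 ha)
    rw [Real.mul_self_sqrt ha.le]
    linarith [h.logN_mul_sqrt_le]
  have hsq : (24 * logN N β) ^ 2 ≤ a := (Real.le_sqrt' (by linarith)).1 hsqrt
  linarith

lemma two_le_logN (hβ : 0 < β) (hβ1 : β < 1) (hN : 2 ≤ N) : 2 ≤ logN N β := by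
  have hN' : (2 : ℝ) ≤ N := Nat.ofNat_le_cast.2 hN
  have hexp : Real.exp 2 ≤ 8 := by
    rw [show (2 : ℝ) = (2 : ℕ) * 1 by norm_num, Real.exp_nat_mul]
    nlinarith [Real.exp_one_lt_d9, Real.exp_pos 1]
  rw [logN, Real.le_log_iff_exp_le (by positivity)]
  exact (by linarith : Real.exp 2 ≤ 4 * N).trans (le_div_self (by positivity) hβ hβ1.le)

lemma exists_nat_mul_log_le (hw : 1 ≤ w) (hwu : w ≤ u ^ 2) (hu : 2 ≤ u) (hβ : 0 < β)
    (hβ1 : β < 1) : ∃ N : ℕ, 65536 * (w * Real.log (u / β)) ≤ N ∧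
      N ≤ 2 * 65536 * (w * Real.log (u / β)) ∧ 1 ≤ N ∧ 2 ≤ logN N β ∧
      700 * w * logN N β ≤ N := by
  have hlam := half_lt_log_div hu hβ hβ1
  set t := 65536 * (w * Real.log (u / β))
  have ht2 : 2 ≤ t := by nlinarith [mul_le_mul hw hlam.le (by norm_num) (by linarith)]
  have htN : t ≤ ⌈t⌉₊ := Nat.le_ceil t
  have hNt : ⌈t⌉₊ < t + 1 := Nat.ceil_lt_add_one (by linarith)
  have hN2 : 2 ≤ ⌈t⌉₊ := by exact_mod_cast ht2.trans htN
  exact ⟨⌈t⌉₊, htN, by linarith, by omega, two_le_logN hβ hβ1 hN2,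
    mul_log_le_of_mul_log_div_le (by linarith) hwu hu hβ hβ1 htN⟩

lemma aConst_eq (a₀ : ℝ) (N : ℕ) (β : ℝ) : aConst a₀ N β = a₀ * (N * √N) * √(logN N β) := by
  rw [aConst, show (3 / 2 : ℝ) = 1 + 1 / 2 by norm_num,
    Real.rpow_one_add' (Nat.cast_nonneg N) (by norm_num), ← Real.sqrt_eq_rpow]

lemma mul_sqrt_le_sqrt {l x : ℝ} (hl : 0 ≤ l) (h : 700 * v ^ 2 * l ≤ x) : 26 * v * √l ≤ √x := by
  refine Real.le_sqrt_of_sq_le ?_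
  rw [mul_pow, Real.sq_sqrt hl]
  linarith [mul_nonneg (sq_nonneg v) hl]

lemma sq_logN_le_aConst (hv : 0 < v) (ha₀ : 1 ≤ a₀ * v ^ 3) (hl : 2 ≤ logN N β)
    (hN : 700 * v ^ 2 * logN N β ≤ N) : 648 * logN N β ^ 2 ≤ aConst a₀ N β := by
  have ha₀pos : 0 < a₀ := pos_of_mul_pos_left (zero_lt_one.trans_le ha₀) (by positivity)
  have hsqrt := mul_sqrt_le_sqrt (by linarith) hN
  rw [aConst_eq]
  set l := logN N β
  have hl0 : 0 ≤ l := by linarith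
  calc 648 * l ^ 2 ≤ 18200 * l ^ 2 * (a₀ * v ^ 3) := by nlinarith [sq_nonneg l]
    _ = a₀ * ((700 * v ^ 2 * l) * (26 * v * √l)) * √l := by
        linear_combination (-(18200 * l * (a₀ * v ^ 3))) * Real.sq_sqrt hl0
    _ ≤ a₀ * (N * √N) * √l := by gcongr

lemma exists_admissible_aMedium (hβ : 0 < β) (hβ1 : β < 1) (hε : 0 < ε)
    (hεR : ε ≤ L * R₀ ^ 2 / 2) : ∃ N : ℕ, Admissible N β (aMedium N β) ∧
      65536 * (L * R₀ ^ 2 / ε * Real.log (L * R₀ ^ 2 / (ε * β))) ≤ N ∧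
      N ≤ 2 * 65536 * (L * R₀ ^ 2 / ε * Real.log (L * R₀ ^ 2 / (ε * β))) := by
  rw [← div_div]
  have hu : 2 ≤ L * R₀ ^ 2 / ε := (le_div_iff₀ hε).2 (by linarith)
  set u := L * R₀ ^ 2 / ε
  obtain ⟨N, hTN, hNT, hN, hl, hNl⟩ := exists_nat_mul_log_le (by linarith : 1 ≤ u)
    (le_self_pow₀ (by linarith) two_ne_zero) hu hβ hβ1
  refine ⟨N, ⟨hN, hl, (aMin_le hl).trans ?_⟩, hTN, hNT⟩
  calc 648 * logN N β ^ 2 ≤ 700 * u * logN N β * logN N β := by nlinarith [sq_nonneg (logN N β)]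
    _ ≤ aMedium N β := mul_le_mul_of_nonneg_right hNl (by linarith)

lemma sq_mul_log_eq (a₀ L R₀ ε β : ℝ) :
    a₀ ^ 2 * L ^ 2 * R₀ ^ 4 / ε ^ 2 * Real.log (a₀ * L * R₀ ^ 2 / (ε * β)) =
      (a₀ * L * R₀ ^ 2 / ε) ^ 2 * Real.log (a₀ * L * R₀ ^ 2 / ε / β) := by
  rw [div_div]
  ring

lemma exists_admissible_aConst (hβ : 0 < β) (hβ1 : β < 1) (hε : 0 < ε)
    (hεR : ε ≤ a₀ * L * R₀ ^ 2 / 2) (hεa : ε ^ 3 ≤ a₀ ^ 4 * (L * R₀ ^ 2) ^ 3) :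
    ∃ N : ℕ, Admissible N β (aConst a₀ N β) ∧
      65536 * (a₀ ^ 2 * L ^ 2 * R₀ ^ 4 / ε ^ 2 *
        Real.log (a₀ * L * R₀ ^ 2 / (ε * β))) ≤ N ∧
      N ≤ 2 * 65536 * (a₀ ^ 2 * L ^ 2 * R₀ ^ 4 / ε ^ 2 *
        Real.log (a₀ * L * R₀ ^ 2 / (ε * β))) := by
  rw [sq_mul_log_eq]
  have hv : 2 ≤ a₀ * L * R₀ ^ 2 / ε := (le_div_iff₀ hε).2 (by linarith)
  have hav : 1 ≤ a₀ * (a₀ * L * R₀ ^ 2 / ε) ^ 3 := by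
    rw [div_pow, ← mul_div_assoc, one_le_div (by positivity)]
    linarith
  set v := a₀ * L * R₀ ^ 2 / ε
  obtain ⟨N, hTN, hNT, hN, hl, hNl⟩ :=
    exists_nat_mul_log_le (one_le_pow₀ (by linarith)) le_rfl hv hβ hβ1
  exact ⟨N, ⟨hN, hl, (aMin_le hl).trans (sq_logN_le_aConst (by linarith) hav hl hNl)⟩, hTN, hNT⟩

end Admissibility

/-! ### Batchsizes and oracle calls -/

section Batchsize

variable {N k : ℕ} {a a₀ L σ R₀ β ε : ℝ}

lemma stepα_aMedium_sq (L : ℝ) (N k : ℕ) (β : ℝ) : stepα (aMedium N β) L (k + 1) ^ 2 =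
    ((k : ℝ) + 2) ^ 2 / (4 * L ^ 2 * N ^ 2 * logN N β ^ 2) := by
  rw [stepα, aMedium, div_pow]
  congr 1
  ring

lemma stepα_aConst_sq (hl : 0 ≤ logN N β) (a₀ L : ℝ) (k : ℕ) :
    stepα (aConst a₀ N β) L (k + 1) ^ 2 =
      ((k : ℝ) + 2) ^ 2 / (4 * a₀ ^ 2 * L ^ 2 * N ^ 3 * logN N β) := by
  rw [stepα, aConst_eq, div_pow]
  simp only [mul_pow]
  rw [Real.sq_sqrt (Nat.cast_nonneg N), Real.sq_sqrt hl]
  congr 1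
  ring

lemma batchReal_aMedium (hN : 1 ≤ N) (hl : logN N β ≠ 0) (L σ R₀ : ℝ) (k : ℕ) :
    batchReal L σ R₀ (aMedium N β) N β k = max 1 (max
      (6000 * σ ^ 2 * ((k : ℝ) + 2) ^ 2 / (4 * L ^ 2 * N * √5 ^ 2 * R₀ ^ 2 * logN N β))
      (10368 * σ ^ 2 * ((k : ℝ) + 2) ^ 2 /
        (4 * L ^ 2 * √5 ^ 2 * R₀ ^ 2 * N * logN N β ^ 2))) := by
  have hN0 : (N : ℝ) ≠ 0 := Nat.cast_ne_zero.2 (by omega)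
  rw [batchReal, stepα_aMedium_sq]
  congr 2 <;> field_simp

lemma batchReal_aConst (hN : 1 ≤ N) (hl : 0 < logN N β) (a₀ L σ R₀ : ℝ) (k : ℕ) :
    batchReal L σ R₀ (aConst a₀ N β) N β k = max 1 (max
      (6000 * σ ^ 2 * ((k : ℝ) + 2) ^ 2 / (4 * a₀ ^ 2 * L ^ 2 * N ^ 2 * √5 ^ 2 * R₀ ^ 2))
      (10368 * σ ^ 2 * ((k : ℝ) + 2) ^ 2 /
        (4 * a₀ ^ 2 * L ^ 2 * √5 ^ 2 * R₀ ^ 2 * N ^ 2 * logN N β))) := by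
  have hN0 : (N : ℝ) ≠ 0 := Nat.cast_ne_zero.2 (by omega)
  rw [batchReal, stepα_aConst_sq hl.le]
  congr 2 <;> field_simp

lemma batchSize_le (hl : 2 ≤ logN N β) (L σ R₀ a : ℝ) (k : ℕ) :
    (batchSize L σ R₀ a N β k : ℝ) ≤
      2 + 2240 * (σ ^ 2 * (stepα a L (k + 1) ^ 2 * (N * logN N β)) / R₀ ^ 2) := by
  set q := σ ^ 2 * stepα a L (k + 1) ^ 2 * N / R₀ ^ 2 with hq
  have hq0 : 0 ≤ q := by positivity
  have hreal : batchReal L σ R₀ a N β k = max 1 (max (1200 * (q * logN N β)) (10368 / 5 * q)) := by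
    rw [batchReal, Real.sq_sqrt (by norm_num), hq]
    congr 2 <;> ring
  have hqN : 2 * q ≤ q * logN N β := by nlinarith
  have hle : batchReal L σ R₀ a N β k ≤ 1 + 2240 * (q * logN N β) := by
    rw [hreal]
    exact max_le (by linarith) (max_le (by linarith) (by linarith))
  have hceil : (batchSize L σ R₀ a N β k : ℝ) < batchReal L σ R₀ a N β k + 1 :=
    Nat.ceil_lt_add_one (zero_le_one.trans (le_max_left _ _))
  have hform : q * logN N β = σ ^ 2 * (stepα a L (k + 1) ^ 2 * (N * logN N β)) / R₀ ^ 2 := by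
    rw [hq]
    ring
  linarith

lemma batchSize_aMedium_le (hl : 2 ≤ logN N β) (hk : k < N) (L σ R₀ : ℝ) :
    (batchSize L σ R₀ (aMedium N β) N β k : ℝ) ≤
      2 + 2240 * (σ ^ 2 / (L ^ 2 * R₀ ^ 2) * (N / logN N β)) := by
  have hN : (0 : ℝ) < N := Nat.cast_pos.2 (by omega)
  have hk2 : (k : ℝ) + 2 ≤ 2 * N := by
    have : (k : ℝ) + 1 ≤ N := by exact_mod_cast hk
    linarith
  refine (batchSize_le hl L σ R₀ _ k).trans ?_
  rw [stepα_aMedium_sq]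
  set l := logN N β
  have : 0 < l := by linarith
  calc 2 + 2240 * (σ ^ 2 * (((k : ℝ) + 2) ^ 2 / (4 * L ^ 2 * N ^ 2 * l ^ 2) * (N * l)) / R₀ ^ 2)
      ≤ 2 + 2240 * (σ ^ 2 * ((2 * N) ^ 2 / (4 * L ^ 2 * N ^ 2 * l ^ 2) * (N * l)) / R₀ ^ 2) := by
        gcongr
    _ = 2 + 2240 * (σ ^ 2 / (L ^ 2 * R₀ ^ 2) * (N / l)) := by
        field_simp
        ring

lemma batchSize_aConst_le (hN : 1 ≤ N) (hl : 2 ≤ logN N β) (hk : k ≤ N) (a₀ L σ R₀ : ℝ) :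
    (batchSize L σ R₀ (aConst a₀ N β) N β k : ℝ) ≤
      2 + 5040 * (σ ^ 2 / (a₀ ^ 2 * L ^ 2 * R₀ ^ 2)) := by
  have hN1 : (1 : ℝ) ≤ N := Nat.one_le_cast.2 hN
  have hk2 : (k : ℝ) + 2 ≤ 3 * N := by
    have : (k : ℝ) ≤ N := Nat.cast_le.2 hk
    linarith
  refine (batchSize_le hl L σ R₀ _ k).trans ?_
  rw [stepα_aConst_sq (by linarith)]
  set l := logN N β
  have : 0 < l := by linarith
  calc 2 + 2240 * (σ ^ 2 * (((k : ℝ) + 2) ^ 2 / (4 * a₀ ^ 2 * L ^ 2 * N ^ 3 * l) * (N * l)) /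
        R₀ ^ 2)
      ≤ 2 + 2240 * (σ ^ 2 * ((3 * N) ^ 2 / (4 * a₀ ^ 2 * L ^ 2 * N ^ 3 * l) * (N * l)) /
        R₀ ^ 2) := by gcongr
    _ = 2 + 5040 * (σ ^ 2 / (a₀ ^ 2 * L ^ 2 * R₀ ^ 2)) := by
        field_simp
        ring

lemma oracleCalls_le {C : ℝ} (h : ∀ k < N, (batchSize L σ R₀ a N β k : ℝ) ≤ C) :
    (oracleCalls L σ R₀ a N β : ℝ) ≤ N * C := by
  rw [oracleCalls, Nat.cast_sum]
  simpa only [Finset.card_range, nsmul_eq_mul] using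
    Finset.sum_le_card_nsmul _ _ C fun k hk => h k (Finset.mem_range.1 hk)

lemma oracleCalls_aMedium_le (hL : 0 < L) (hR₀ : 0 < R₀) (hε : 0 < ε) (hβ : 0 < β) (hβ1 : β < 1)
    (hN : 1 ≤ N) (hl : 2 ≤ logN N β)
    (hNT : N ≤ 2 * 65536 * (L * R₀ ^ 2 / ε * Real.log (L * R₀ ^ 2 / (ε * β)))) :
    (oracleCalls L σ R₀ (aMedium N β) N β : ℝ) ≤
      10 ^ 14 * (max (L * R₀ ^ 2 / ε) (σ ^ 2 * R₀ ^ 2 / ε ^ 2) *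
        Real.log (L * R₀ ^ 2 / (ε * β))) := by
  have hN1 : (1 : ℝ) ≤ N := Nat.one_le_cast.2 hN
  have hu : 0 < L * R₀ ^ 2 / ε := by positivity
  have hvar : σ ^ 2 / (L ^ 2 * R₀ ^ 2) * (L * R₀ ^ 2 / ε) ^ 2 = σ ^ 2 * R₀ ^ 2 / ε ^ 2 := by
    field_simp
  rw [← div_div] at hNT ⊢
  set u := L * R₀ ^ 2 / ε
  set lam := Real.log (u / β)
  set W := σ ^ 2 / (L ^ 2 * R₀ ^ 2)
  have hsq : (N : ℝ) ^ 2 / logN N β ≤ 8 * 65536 ^ 2 * (u ^ 2 * lam) :=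
    sq_div_log_le (by norm_num) hN1 hβ hβ1 hl hu hNT
  have hulam : 0 < u * lam := by linarith
  have hlam : 0 ≤ lam := (pos_of_mul_pos_right hulam hu.le).le
  calc (oracleCalls L σ R₀ (aMedium N β) N β : ℝ)
      ≤ N * (2 + 2240 * (W * (N / logN N β))) :=
        oracleCalls_le fun k hk => batchSize_aMedium_le hl hk L σ R₀
    _ = 2 * N + 2240 * (W * (N ^ 2 / logN N β)) := by ring
    _ ≤ 2 * (2 * 65536 * (u * lam)) + 2240 * (W * (8 * 65536 ^ 2 * (u ^ 2 * lam))) := by gcongr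
    _ = 2 * (2 * 65536 * (u * lam)) + 2240 * (8 * 65536 ^ 2 * (σ ^ 2 * R₀ ^ 2 / ε ^ 2 * lam)) := by
        rw [← hvar]
        ring
    _ ≤ 2 * (2 * 65536 * (max u (σ ^ 2 * R₀ ^ 2 / ε ^ 2) * lam)) +
        2240 * (8 * 65536 ^ 2 * (max u (σ ^ 2 * R₀ ^ 2 / ε ^ 2) * lam)) := by
        gcongr
        exacts [le_max_left _ _, le_max_right _ _]
    _ ≤ 10 ^ 14 * (max u (σ ^ 2 * R₀ ^ 2 / ε ^ 2) * lam) := by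
        have : 0 ≤ max u (σ ^ 2 * R₀ ^ 2 / ε ^ 2) * lam := by positivity
        linarith

lemma oracleCalls_aConst_le (hL : 0 < L) (hR₀ : 0 < R₀) (ha₀ : 0 < a₀) (hε : 0 < ε)
    (hN : 1 ≤ N) (hl : 2 ≤ logN N β) (hNT : N ≤ 2 * 65536 *
      (a₀ ^ 2 * L ^ 2 * R₀ ^ 4 / ε ^ 2 * Real.log (a₀ * L * R₀ ^ 2 / (ε * β)))) :
    (oracleCalls L σ R₀ (aConst a₀ N β) N β : ℝ) ≤
      10 ^ 14 * (max (a₀ ^ 2 * L ^ 2 * R₀ ^ 4 / ε ^ 2) (σ ^ 2 * R₀ ^ 2 / ε ^ 2) *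
        Real.log (a₀ * L * R₀ ^ 2 / (ε * β))) := by
  have hN1 : (1 : ℝ) ≤ N := Nat.one_le_cast.2 hN
  have hu : 0 < a₀ ^ 2 * L ^ 2 * R₀ ^ 4 / ε ^ 2 := by positivity
  have hvar : σ ^ 2 / (a₀ ^ 2 * L ^ 2 * R₀ ^ 2) * (a₀ ^ 2 * L ^ 2 * R₀ ^ 4 / ε ^ 2) =
      σ ^ 2 * R₀ ^ 2 / ε ^ 2 := by field_simp
  set u := a₀ ^ 2 * L ^ 2 * R₀ ^ 4 / ε ^ 2
  set lam := Real.log (a₀ * L * R₀ ^ 2 / (ε * β))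
  set W := σ ^ 2 / (a₀ ^ 2 * L ^ 2 * R₀ ^ 2)
  have hulam : 0 < u * lam := by linarith
  have hlam : 0 ≤ lam := (pos_of_mul_pos_right hulam hu.le).le
  calc (oracleCalls L σ R₀ (aConst a₀ N β) N β : ℝ)
      ≤ N * (2 + 5040 * W) :=
        oracleCalls_le fun k hk => batchSize_aConst_le hN hl hk.le a₀ L σ R₀
    _ ≤ 2 * 65536 * (u * lam) * (2 + 5040 * W) := by gcongr
    _ = 2 * 65536 * (2 * (u * lam) + 5040 * (σ ^ 2 * R₀ ^ 2 / ε ^ 2 * lam)) := by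
        rw [← hvar]
        ring
    _ ≤ 2 * 65536 * (2 * (max u (σ ^ 2 * R₀ ^ 2 / ε ^ 2) * lam) +
        5040 * (max u (σ ^ 2 * R₀ ^ 2 / ε ^ 2) * lam)) := by
        gcongr
        exacts [le_max_left _ _, le_max_right _ _]
    _ ≤ 10 ^ 14 * (max u (σ ^ 2 * R₀ ^ 2 / ε ^ 2) * lam) := by
        have : 0 ≤ max u (σ ^ 2 * R₀ ^ 2 / ε ^ 2) * lam := by positivity
        linarith

end Batchsize

/-! ### Accuracy after `N` iterations -/

section Accuracy

variable {N k : ℕ} {a₀ L σ R₀ β ε : ℝ}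

lemma rate_aMedium_le (h : Admissible N β (aMedium N β)) (hβ : 0 < β) (hβ1 : β < 1) (hε : 0 < ε)
    (hTN : 65536 * (L * R₀ ^ 2 / ε * Real.log (L * R₀ ^ 2 / (ε * β))) ≤ N) :
    10 * aMedium N β * L * R₀ ^ 2 / (N * (N + 3)) ≤ ε := by
  have hN : (0 : ℝ) < N := Nat.cast_pos.2 h.1
  have hl := h.2.1
  have hsq : 576 * logN N β ≤ N := by
    refine le_of_mul_le_mul_right ?_ (by linarith : 0 < logN N β)
    have := h.sq_le
    rw [aMedium] at this
    linarith
  have hlogN : 10 * (L * R₀ ^ 2 / ε) * logN N β ≤ N := by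
    rw [← div_div] at hTN
    rcases le_total 2 (L * R₀ ^ 2 / ε) with hu | hu
    · have : 700 * (L * R₀ ^ 2 / ε) * logN N β ≤ N := mul_log_le_of_mul_log_div_le
        (by linarith) (le_self_pow₀ (by linarith) two_ne_zero) hu hβ hβ1 hTN
      nlinarith
    · nlinarith
  have hrate : 10 * aMedium N β * L * R₀ ^ 2 / (N * (N + 3)) =
      ε * (10 * (L * R₀ ^ 2 / ε) * logN N β / (N + 3)) := by
    rw [aMedium]
    field_simp
  rw [hrate]
  exact mul_le_of_le_one_right hε.le ((div_le_one (by positivity)).2 (by linarith))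

lemma rate_aConst_le (hN : 1 ≤ N) (hl : 0 ≤ logN N β) (hβ : 0 < β) (hβ1 : β < 1)
    (hε : 0 < ε) (hεR : ε ≤ a₀ * L * R₀ ^ 2 / 2) (hTN : 65536 * (a₀ ^ 2 * L ^ 2 * R₀ ^ 4 / ε ^ 2 *
      Real.log (a₀ * L * R₀ ^ 2 / (ε * β))) ≤ N) :
    10 * aConst a₀ N β * L * R₀ ^ 2 / (N * (N + 3)) ≤ ε := by
  have hN0 : (0 : ℝ) < N := Nat.cast_pos.2 hN
  have hv : 2 ≤ a₀ * L * R₀ ^ 2 / ε := (le_div_iff₀ hε).2 (by linarith)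
  have hrate : 10 * aConst a₀ N β * L * R₀ ^ 2 / (N * (N + 3)) =
      ε * (√N * (10 * (a₀ * L * R₀ ^ 2 / ε) * √(logN N β)) / (N + 3)) := by
    rw [aConst_eq]
    field_simp
  rw [sq_mul_log_eq] at hTN
  set v := a₀ * L * R₀ ^ 2 / ε
  have hlogN : 700 * v ^ 2 * logN N β ≤ N :=
    mul_log_le_of_mul_log_div_le (by positivity) le_rfl hv hβ hβ1 hTN
  have hsqrt : 10 * v * √(logN N β) ≤ √N := by
    refine le_trans ?_ (mul_sqrt_le_sqrt hl hlogN)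
    gcongr
    norm_num
  rw [hrate]
  refine mul_le_of_le_one_right hε.le ((div_le_one (by positivity)).2 ?_)
  calc √N * (10 * v * √(logN N β)) ≤ √N * √N := by gcongr
    _ = N := Real.mul_self_sqrt (Nat.cast_nonneg N)
    _ ≤ N + 3 := by linarith

lemma div_mul_mul_mul_sq (hL : L ≠ 0) (hR₀ : R₀ ≠ 0) (σ : ℝ) :
    σ / (L * R₀) * L * R₀ ^ 2 = σ * R₀ := by
  field_simp

lemma div_mul_sq_mul_sq_mul_pow (hL : L ≠ 0) (hR₀ : R₀ ≠ 0) (σ : ℝ) :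
    (σ / (L * R₀)) ^ 2 * L ^ 2 * R₀ ^ 4 = σ ^ 2 * R₀ ^ 2 := by
  field_simp

lemma rate_aConst_div_le (hL : L ≠ 0) (hR₀ : R₀ ≠ 0) (hN : 1 ≤ N) (hl : 0 ≤ logN N β)
    (hβ : 0 < β) (hβ1 : β < 1) (hε : 0 < ε) (hεR : ε ≤ σ * R₀ / 2)
    (hTN : 65536 * (σ ^ 2 * R₀ ^ 2 / ε ^ 2 * Real.log (σ * R₀ / (ε * β))) ≤ N) :
    10 * aConst (σ / (L * R₀)) N β * L * R₀ ^ 2 / (N * (N + 3)) ≤ ε := by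
  rw [← div_mul_mul_mul_sq hL hR₀] at hεR hTN
  rw [← div_mul_sq_mul_sq_mul_pow hL hR₀] at hTN
  exact rate_aConst_le hN hl hβ hβ1 hε hεR hTN

lemma exists_admissible_aConst_div (hL : 0 < L) (hR₀ : R₀ ≠ 0) (hβ : 0 < β) (hβ1 : β < 1)
    (hε : 0 < ε) (hεR : ε ≤ σ * R₀ / 2) (hεσ : L * ε ^ 3 ≤ σ ^ 4 * R₀ ^ 2) :
    ∃ N : ℕ, Admissible N β (aConst (σ / (L * R₀)) N β) ∧
      65536 * (σ ^ 2 * R₀ ^ 2 / ε ^ 2 * Real.log (σ * R₀ / (ε * β))) ≤ N ∧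
      N ≤ 2 * 65536 * (σ ^ 2 * R₀ ^ 2 / ε ^ 2 * Real.log (σ * R₀ / (ε * β))) := by
  have hcube : ε ^ 3 ≤ (σ / (L * R₀)) ^ 4 * (L * R₀ ^ 2) ^ 3 := by
    have : (σ / (L * R₀)) ^ 4 * (L * R₀ ^ 2) ^ 3 = σ ^ 4 * R₀ ^ 2 / L := by field_simp
    rw [this, le_div_iff₀ hL]
    linarith
  rw [← div_mul_mul_mul_sq hL.ne' hR₀] at hεR
  have hN := exists_admissible_aConst hβ hβ1 hε hεR hcube
  rwa [div_mul_sq_mul_sq_mul_pow hL.ne' hR₀, div_mul_mul_mul_sq hL.ne' hR₀] at hN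

lemma batchSize_aConst_div_le (hσ : σ ≠ 0) (hL : L ≠ 0) (hR₀ : R₀ ≠ 0) (hN : 1 ≤ N)
    (hl : 2 ≤ logN N β) (hk : k ≤ N) :
    (batchSize L σ R₀ (aConst (σ / (L * R₀)) N β) N β k : ℝ) ≤ 5042 := by
  refine (batchSize_aConst_le hN hl hk (σ / (L * R₀)) L σ R₀).trans_eq ?_
  field_simp
  norm_num

end Accuracy

end ClippedSSTM

theorem mainTheorem2 :
    ∃ K K' : ℝ, 0 < K ∧ 0 < K' ∧
      ∀ (n : ℕ) (Ξ : Type*) (Ω : Type*) [MeasurableSpace Ξ] [MeasurableSpace Ω]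
        (P : Measure Ξ) [IsProbabilityMeasure P] (μ : Measure Ω) [IsProbabilityMeasure μ]
        (f : ClippedSSTM.Euc n → ℝ) (G : ClippedSSTM.Euc n → Ξ → ClippedSSTM.Euc n)
        (ξ : ℕ × ℕ → Ω → Ξ) (x₀ xs : ClippedSSTM.Euc n) (L σ R₀ β : ℝ),
        0 < L → 0 ≤ σ → 0 < β → β < 1 →
        ConvexOn ℝ Set.univ f → ClippedSSTM.LSmooth f L →
        ClippedSSTM.IsStochasticGradient f P G σ →
        ClippedSSTM.IsIIDSample μ P ξ →
        (∀ x, f xs ≤ f x) → R₀ = ‖x₀ - xs‖ → 0 < R₀ →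
        -- medium batchsizes
        ((∀ N : ℕ, ClippedSSTM.Admissible N β (ClippedSSTM.aMedium N β) →
            (∀ k : ℕ, ClippedSSTM.batchReal L σ R₀ (ClippedSSTM.aMedium N β) N β k =
              max 1 (max
                (6000 * σ ^ 2 * ((k : ℝ) + 2) ^ 2 /
                  (4 * L ^ 2 * N * √5 ^ 2 * R₀ ^ 2 * Real.log (4 * N / β)))
                (10368 * σ ^ 2 * ((k : ℝ) + 2) ^ 2 /
                  (4 * L ^ 2 * √5 ^ 2 * R₀ ^ 2 * N * Real.log (4 * N / β) ^ 2)))) ∧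
            (∀ ε : ℝ, 0 < ε →
              K * (L * R₀ ^ 2 / ε * Real.log (L * R₀ ^ 2 / (ε * β))) ≤ N →
              1 - β ≤ μ.real {ω | f (ClippedSSTM.output G ξ x₀ L σ R₀
                (ClippedSSTM.aMedium N β) N β ω) - f xs ≤ ε}) ∧
            (∀ ε : ℝ, 0 < ε →
              N ≤ 2 * K * (L * R₀ ^ 2 / ε * Real.log (L * R₀ ^ 2 / (ε * β))) →
              (ClippedSSTM.oracleCalls L σ R₀ (ClippedSSTM.aMedium N β) N β : ℝ) ≤
                K' * (max (L * R₀ ^ 2 / ε) (σ ^ 2 * R₀ ^ 2 / ε ^ 2) *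
                  Real.log (L * R₀ ^ 2 / (ε * β))))) ∧
          (∀ ε : ℝ, 0 < ε → ε ≤ L * R₀ ^ 2 / 2 →
            ∃ N : ℕ, ClippedSSTM.Admissible N β (ClippedSSTM.aMedium N β) ∧
              K * (L * R₀ ^ 2 / ε * Real.log (L * R₀ ^ 2 / (ε * β))) ≤ N ∧
              N ≤ 2 * K * (L * R₀ ^ 2 / ε * Real.log (L * R₀ ^ 2 / (ε * β))))) ∧
        -- constant batchsizes
        (∀ a₀ : ℝ, 0 < a₀ →
          (∀ N : ℕ, ClippedSSTM.Admissible N β (ClippedSSTM.aConst a₀ N β) →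
            (∀ k : ℕ, ClippedSSTM.batchReal L σ R₀ (ClippedSSTM.aConst a₀ N β) N β k =
              max 1 (max
                (6000 * σ ^ 2 * ((k : ℝ) + 2) ^ 2 /
                  (4 * a₀ ^ 2 * L ^ 2 * N ^ 2 * √5 ^ 2 * R₀ ^ 2))
                (10368 * σ ^ 2 * ((k : ℝ) + 2) ^ 2 /
                  (4 * a₀ ^ 2 * L ^ 2 * √5 ^ 2 * R₀ ^ 2 * N ^ 2 * Real.log (4 * N / β))))) ∧
            (∀ ε : ℝ, 0 < ε → ε ≤ a₀ * L * R₀ ^ 2 / 2 →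
              K * (a₀ ^ 2 * L ^ 2 * R₀ ^ 4 / ε ^ 2 *
                Real.log (a₀ * L * R₀ ^ 2 / (ε * β))) ≤ N →
              1 - β ≤ μ.real {ω | f (ClippedSSTM.output G ξ x₀ L σ R₀
                (ClippedSSTM.aConst a₀ N β) N β ω) - f xs ≤ ε}) ∧
            (∀ ε : ℝ, 0 < ε →
              N ≤ 2 * K * (a₀ ^ 2 * L ^ 2 * R₀ ^ 4 / ε ^ 2 *
                Real.log (a₀ * L * R₀ ^ 2 / (ε * β))) →
              (ClippedSSTM.oracleCalls L σ R₀ (ClippedSSTM.aConst a₀ N β) N β : ℝ) ≤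
                K' * (max (a₀ ^ 2 * L ^ 2 * R₀ ^ 4 / ε ^ 2) (σ ^ 2 * R₀ ^ 2 / ε ^ 2) *
                  Real.log (a₀ * L * R₀ ^ 2 / (ε * β))))) ∧
          (∀ ε : ℝ, 0 < ε → ε ≤ a₀ * L * R₀ ^ 2 / 2 → ε ^ 3 ≤ a₀ ^ 4 * (L * R₀ ^ 2) ^ 3 →
            ∃ N : ℕ, ClippedSSTM.Admissible N β (ClippedSSTM.aConst a₀ N β) ∧
              K * (a₀ ^ 2 * L ^ 2 * R₀ ^ 4 / ε ^ 2 *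
                Real.log (a₀ * L * R₀ ^ 2 / (ε * β))) ≤ N ∧
              N ≤ 2 * K * (a₀ ^ 2 * L ^ 2 * R₀ ^ 4 / ε ^ 2 *
                Real.log (a₀ * L * R₀ ^ 2 / (ε * β))))) ∧
        -- constant batchsizes with `a₀ = σ / (L R₀)`
        (0 < σ →
          (∀ N : ℕ, ClippedSSTM.Admissible N β (ClippedSSTM.aConst (σ / (L * R₀)) N β) →
            (∀ k : ℕ, k ≤ N → (ClippedSSTM.batchSize L σ R₀
              (ClippedSSTM.aConst (σ / (L * R₀)) N β) N β k : ℝ) ≤ K') ∧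
            (∀ ε : ℝ, 0 < ε → ε ≤ σ * R₀ / 2 →
              K * (σ ^ 2 * R₀ ^ 2 / ε ^ 2 * Real.log (σ * R₀ / (ε * β))) ≤ N →
              1 - β ≤ μ.real {ω | f (ClippedSSTM.output G ξ x₀ L σ R₀
                (ClippedSSTM.aConst (σ / (L * R₀)) N β) N β ω) - f xs ≤ ε})) ∧
          (∀ ε : ℝ, 0 < ε → ε ≤ σ * R₀ / 2 → L * ε ^ 3 ≤ σ ^ 4 * R₀ ^ 2 →
            ∃ N : ℕ, ClippedSSTM.Admissible N β (ClippedSSTM.aConst (σ / (L * R₀)) N β) ∧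
              K * (σ ^ 2 * R₀ ^ 2 / ε ^ 2 * Real.log (σ * R₀ / (ε * β))) ≤ N ∧
              N ≤ 2 * K * (σ ^ 2 * R₀ ^ 2 / ε ^ 2 * Real.log (σ * R₀ / (ε * β))))) := by
  refine ⟨65536, 10 ^ 14, by norm_num, by norm_num, ?_⟩
  intro n Ξ Ω _ _ P _ μ _ f G ξ x₀ xs L σ R₀ β hL _ hβ hβ1 hconv hf hG hξ hxs hR₀ hR₀pos
  have hprob {N : ℕ} {a ε : ℝ} (hadm : ClippedSSTM.Admissible N β a)
      (hrate : 10 * a * L * R₀ ^ 2 / (N * (N + 3)) ≤ ε) :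
      1 - β ≤ μ.real {ω | f (ClippedSSTM.output G ξ x₀ L σ R₀ a N β ω) - f xs ≤ ε} :=
    (hadm.one_sub_le_measure_output_sub_le hL hβ hconv hf hG hξ hxs hR₀ hR₀pos).trans
      (measureReal_mono fun ω hω => le_trans hω hrate)
  have hlog {N : ℕ} {a : ℝ} (hadm : ClippedSSTM.Admissible N β a) :
      0 < ClippedSSTM.logN N β := two_pos.trans_le hadm.2.1
  refine ⟨⟨fun N hadm => ⟨?_, ?_, ?_⟩, ?_⟩, fun a₀ ha₀ => ⟨fun N hadm => ⟨?_, ?_, ?_⟩, ?_⟩,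
    fun hσpos => ⟨fun N hadm => ⟨?_, ?_⟩, ?_⟩⟩
  · exact ClippedSSTM.batchReal_aMedium hadm.1 (hlog hadm).ne' L σ R₀
  · exact fun ε hε hTN => hprob hadm (ClippedSSTM.rate_aMedium_le hadm hβ hβ1 hε hTN)
  · exact fun ε hε => ClippedSSTM.oracleCalls_aMedium_le hL hR₀pos hε hβ hβ1 hadm.1 hadm.2.1
  · exact fun ε => ClippedSSTM.exists_admissible_aMedium hβ hβ1
  · exact ClippedSSTM.batchReal_aConst hadm.1 (hlog hadm) a₀ L σ R₀
  · exact fun ε hε hεR hTN => hprob hadm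
      (ClippedSSTM.rate_aConst_le hadm.1 (hlog hadm).le hβ hβ1 hε hεR hTN)
  · exact fun ε hε => ClippedSSTM.oracleCalls_aConst_le hL hR₀pos ha₀ hε hadm.1 hadm.2.1
  · exact fun ε => ClippedSSTM.exists_admissible_aConst hβ hβ1
  · exact fun k hk => (ClippedSSTM.batchSize_aConst_div_le hσpos.ne' hL.ne' hR₀pos.ne' hadm.1
      hadm.2.1 hk).trans (by norm_num)
  · exact fun ε hε hεR hTN => hprob hadm (ClippedSSTM.rate_aConst_div_le hL.ne' hR₀pos.ne'
      hadm.1 (hlog hadm).le hβ hβ1 hε hεR hTN)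
  · exact fun ε => ClippedSSTM.exists_admissible_aConst_div hL hR₀pos.ne' hβ hβ1
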